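/- Let $E$ be a finite-dimensional real Euclidean space, $\mathfrak h=\mathbb C\otimes_{\mathbb R}E$ its complexification, and $W\subset O(E)$ a finite group generated by reflections. Let $S\subset W$ be the set of all reflections in $W$. For each $s\in S$ let $\alpha_s\in\mathfrak h^*$ be a root of $s$ (a nonzero real linear function vanishing on the hyperplane of $s$) and $\alpha_s^\vee\in\mathfrak h$ the corresponding coroot, and let $c:S\to\mathbb C$, $s\mapsto c_s$, be a function invariant under conjugation by $W$. Let $H_c$ be the rational Cherednik algebra, i.e. the unital associative $\mathbb C$-algebra generated by the vector spaces $\mathfrak h$, $\mathfrak h^*$ and the group $W$, with defining relations $$w x w^{-1}=w(x),\quad w y w^{-1}=w(y),\quad x_1x_2=x_2x_1,\quad y_1y_2=y_2y_1,$$ $$yx-xy=\langle y,x\rangle+\sum_{s\in S}c_s\,\langle y,\alpha_s\rangle\langle\alpha_s^\vee,x\rangle\, s$$ for all $x,x_1,x_2\in\mathfrak h^*$, $y,y_1,y_2\in\mathfrak h$, $w\in W$. Regard $\mathbb C[\mathfrak h]$ and $\mathbb C[\mathfrak h^*]$ as the subalgebras of $H_c$ generated by $\mathfrak h^*$ and by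 $\mathfrak h$, respectively, and let $A^-=\mathbb C^{>0}[\mathfrak h^*]^W$ be the algebra of $W$-invariant polynomials on $\mathfrak h^*$ without constant term. Then: (i) Let $M$ be a finitely generated left $H_c$-module on which the action of $A^-$ is locally finite, i.e. every element of $M$ lies in a finite-dimensional $A^-$-stable subspace (an object of the category $\mathcal O(H_c)$). Then $M$ has finite length as an $H_c$-module. (ii) Let $M$ be a Harish-Chandra $H_c$-bimodule, i.e. a finitely generated $H_c\otimes_{\mathbb C} H_c^{\mathrm{op}}$-module such that, for every $a\in\mathbb C[\mathfrak h]^W$ and every $a\in\mathbb C[\mathfrak h^*]^W$, the operator $m\mapsto am-ma$ on $M$ is locally nilpotent. Then $M$ has finite length as an $H_c\otimes_{\mathbb C} H_c^{\mathrm{op}}$-module. -/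

import Mathlib

open scoped TensorProduct

noncomputable section

namespace RationalCherednik

variable {E : Type*} [NormedAddCommGroup E] [InnerProductSpace ℝ E]

/-- The complexification `𝔥 = ℂ ⊗ E` of the real Euclidean space `E`. -/
abbrev Cplx (E : Type*) [NormedAddCommGroup E] [InnerProductSpace ℝ E] : Type _ := ℂ ⊗[ℝ] E

/-- The dual space `𝔥*`. -/
abbrev CplxDual (E : Type*) [NormedAddCommGroup E] [InnerProductSpace ℝ E] : Type _ :=
  Module.Dual ℂ (Cplx E)

/-- The set `S` of all elements of `W` that are orthogonal reflections in a hyperplane of `E`. -/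
def reflections (W : Subgroup (E ≃ₗᵢ[ℝ] E)) : Set W :=
  {w | ∃ v : E, v ≠ 0 ∧ (w : E ≃ₗᵢ[ℝ] E) = (ℝ ∙ v)ᗮ.reflection}

/-- `W` is a finite Coxeter group in `E`: finite and generated by its reflections. -/
structure IsFiniteCoxeter (W : Subgroup (E ≃ₗᵢ[ℝ] E)) : Prop where
  finite : Finite W
  generated : Subgroup.closure (reflections W) = ⊤

/-- A choice of roots: to every reflection `s` a nonzero vector `α s` orthogonal to the hyperplane
of `s` (identified, through the inner product, with a linear function vanishing on it). -/
structure IsRootChoice (W : Subgroup (E ≃ₗᵢ[ℝ] E)) (α : reflections W → E) : Prop where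
  ne_zero : ∀ s, α s ≠ 0
  reflection_eq : ∀ s : reflections W, ((s : W) : E ≃ₗᵢ[ℝ] E) = (ℝ ∙ α s)ᗮ.reflection

/-- `c : S → ℂ` is invariant under conjugation by `W`. -/
def IsInvariantParameter (W : Subgroup (E ≃ₗᵢ[ℝ] E)) (c : reflections W → ℂ) : Prop :=
  ∀ (w : W) (s t : reflections W), (t : W) = w * s * w⁻¹ → c t = c s

/-- The complex-linear action of an isometry `w` of `E` on `𝔥`. -/
def act (w : E ≃ₗᵢ[ℝ] E) : Cplx E →ₗ[ℂ] Cplx E :=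
  LinearMap.baseChange ℂ (w.toLinearEquiv : E →ₗ[ℝ] E)

/-- The contragredient action on `𝔥*`: `(w x)(y) = x (w⁻¹ y)`. -/
def actDual (w : E ≃ₗᵢ[ℝ] E) (x : CplxDual E) : CplxDual E := x ∘ₗ act w⁻¹

/-- The complex-linear extension to `𝔥` of the linear function `(v, -)` on `E`. -/
def rootForm (v : E) : CplxDual E := Module.Dual.baseChange ℂ (innerₗ E v)

/-- The coroot `2 v / (v, v)`, as an element of `𝔥`. -/
def coroot (v : E) : Cplx E := (1 : ℂ) ⊗ₜ[ℝ] ((2 / inner ℝ v v : ℝ) • v)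

/-- The generators of the rational Cherednik algebra: the elements of `𝔥`, `𝔥*` and `W`. -/
inductive Gen (W : Subgroup (E ≃ₗᵢ[ℝ] E)) : Type _
  | y : Cplx E → Gen W
  | x : CplxDual E → Gen W
  | w : W → Gen W

variable (W : Subgroup (E ≃ₗᵢ[ℝ] E)) (α : reflections W → E) (c : reflections W → ℂ)

/-- A generator in the free algebra. -/
def gen (g : Gen W) : FreeAlgebra ℂ (Gen W) := FreeAlgebra.ι ℂ g

/-- The defining relations of `H_c`. The first six say that `𝔥` and `𝔥*` enter as vector spaces and
`W` as a group; the others are the commutation relations. -/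
inductive Rel : FreeAlgebra ℂ (Gen W) → FreeAlgebra ℂ (Gen W) → Prop
  | y_add (y₁ y₂ : Cplx E) : Rel (gen W (.y (y₁ + y₂))) (gen W (.y y₁) + gen W (.y y₂))
  | y_smul (a : ℂ) (y : Cplx E) : Rel (gen W (.y (a • y))) (a • gen W (.y y))
  | x_add (x₁ x₂ : CplxDual E) : Rel (gen W (.x (x₁ + x₂))) (gen W (.x x₁) + gen W (.x x₂))
  | x_smul (a : ℂ) (x : CplxDual E) : Rel (gen W (.x (a • x))) (a • gen W (.x x))
  | w_one : Rel (gen W (.w 1)) 1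
  | w_mul (w₁ w₂ : W) : Rel (gen W (.w (w₁ * w₂))) (gen W (.w w₁) * gen W (.w w₂))
  | w_x (w : W) (x : CplxDual E) :
      Rel (gen W (.w w) * gen W (.x x) * gen W (.w w⁻¹)) (gen W (.x (actDual w x)))
  | w_y (w : W) (y : Cplx E) :
      Rel (gen W (.w w) * gen W (.y y) * gen W (.w w⁻¹)) (gen W (.y (act w y)))
  | x_comm (x₁ x₂ : CplxDual E) :
      Rel (gen W (.x x₁) * gen W (.x x₂)) (gen W (.x x₂) * gen W (.x x₁))
  | y_comm (y₁ y₂ : Cplx E) :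
      Rel (gen W (.y y₁) * gen W (.y y₂)) (gen W (.y y₂) * gen W (.y y₁))
  | y_x (y : Cplx E) (x : CplxDual E) :
      Rel (gen W (.y y) * gen W (.x x) - gen W (.x x) * gen W (.y y))
        (algebraMap ℂ _ (x y) +
          ∑ᶠ s : reflections W, (c s * rootForm (α s) y * x (coroot (α s))) • gen W (.w s))

/-- The rational Cherednik algebra `H_c` (at `t = 1`). -/
def Cherednik : Type _ := RingQuot (Rel W α c)

instance : Ring (Cherednik W α c) := inferInstanceAs (Ring (RingQuot (Rel W α c)))

instance : Algebra ℂ (Cherednik W α c) := inferInstanceAs (Algebra ℂ (RingQuot (Rel W α c)))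

/-- The image of a generator in `H_c`. -/
def of (g : Gen W) : Cherednik W α c := RingQuot.mkAlgHom ℂ (Rel W α c) (gen W g)

/-- The image of `𝔥*` in `H_c`. -/
def xSet : Set (Cherednik W α c) := Set.range fun x => of W α c (.x x)

/-- The image of `𝔥` in `H_c`. -/
def ySet : Set (Cherednik W α c) := Set.range fun y => of W α c (.y y)

/-- The image of `W` in `H_c`. -/
def wSet : Set (Cherednik W α c) := Set.range fun w => of W α c (.w w)

/-- `ℂ[𝔥]^W` inside `H_c`: the subalgebra generated by `𝔥*` is `ℂ[𝔥]`, on which `W` acts by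
conjugation, so that its invariants are the elements commuting with `W`. -/
def invX : Subalgebra ℂ (Cherednik W α c) :=
  Algebra.adjoin ℂ (xSet W α c) ⊓ Subalgebra.centralizer ℂ (wSet W α c)

/-- `ℂ[𝔥*]^W` inside `H_c`. -/
def invY : Subalgebra ℂ (Cherednik W α c) :=
  Algebra.adjoin ℂ (ySet W α c) ⊓ Subalgebra.centralizer ℂ (wSet W α c)

/-- `A⁻`, the `W`-invariants without constant term in `ℂ[𝔥*]`, inside `H_c`: the non-unital
subalgebra generated by `𝔥` consists of the polynomials without constant term. -/
def Aminus : NonUnitalSubalgebra ℂ (Cherednik W α c) :=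
  NonUnitalAlgebra.adjoin ℂ (ySet W α c) ⊓ NonUnitalSubalgebra.centralizer ℂ (wSet W α c)

/-- The objects of the category `O(H_c)`: finitely generated left `H_c`-modules on which the action
of `A⁻` is locally finite, i.e. every element lies in a finite-dimensional `A⁻`-stable subspace. -/
structure IsCategoryO (M : Type*) [AddCommGroup M] [Module ℂ M] [Module (Cherednik W α c) M]
    [IsScalarTower ℂ (Cherednik W α c) M] : Prop where
  finite : Module.Finite (Cherednik W α c) M
  locallyFinite : ∀ m : M, ∃ N : Submodule ℂ M, FiniteDimensional ℂ N ∧ m ∈ N ∧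
    ∀ a ∈ Aminus W α c, ∀ n ∈ N, a • n ∈ N

/-- The enveloping algebra `H_c ⊗ H_c^op`; its left modules are the `H_c`-bimodules. -/
abbrev Env : Type _ := Cherednik W α c ⊗[ℂ] (Cherednik W α c)ᵐᵒᵖ

/-- The element `a ⊗ 1 - 1 ⊗ a`, which acts on a bimodule by `m ↦ a m - m a`. -/
def adElt (a : Cherednik W α c) : Env W α c := a ⊗ₜ[ℂ] 1 - 1 ⊗ₜ[ℂ] MulOpposite.op a

/-- Harish-Chandra bimodules: finitely generated `H_c`-bimodules on which `ad a` is locally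
nilpotent for every `a` in `ℂ[𝔥]^W` and every `a` in `ℂ[𝔥*]^W`. -/
structure IsHarishChandra (M : Type*) [AddCommGroup M] [Module (Env W α c) M] : Prop where
  finite : Module.Finite (Env W α c) M
  ad_nilpotent_x : ∀ a ∈ invX W α c, ∀ m : M, ∃ n : ℕ, adElt W α c a ^ n • m = 0
  ad_nilpotent_y : ∀ a ∈ invY W α c, ∀ m : M, ∃ n : ℕ, adElt W α c a ^ n • m = 0

end RationalCherednik

end

noncomputable section

namespace RationalCherednik

open MvPolynomial

/-! Both parts reduce to one criterion: a module over a Cherednik-type algebra that is finitely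
generated over the polynomials in the coordinates has finite length (`Realization.isFiniteLength`).

Reduction. The algebra is spanned by products (polynomial in x)(group)(polynomial in y), and
polynomials are finite over invariants. In (i) a finite-dimensional generating space stable under
the invariants in y therefore generates a finite module over `ℂ[𝔥]`. In (ii) the enveloping algebra
is again of Cherednik type, for `W × W`, if in the opposite factor coordinates and momenta are
exchanged; its coordinates are then the left x and the right y. Local nilpotency of `ad` lets left y
be traded for right y and right x for left x, up to finite-dimensional spaces, so a Harish-Chandra
bimodule is finite over these coordinates.

The criterion. Only the descending chain condition is at issue. A G-equivariant vector field `δ`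
lifts to an element of the algebra whose commutator with a polynomial `p` is `δ p`: the correction
to `∑ δ(x_i) y_i` uses that the root divides `δ` of itself (`Realization.lift_mul_poly`). Such lifts
have two consequences.

Support: the annihilator of a subquotient `N / N'` is stable under equivariant vector fields, so if
it vanishes at `b₀` it vanishes wherever the stabilizer contains that of `b₀`
(`le_pointIdeal_of_stable`). Finitely many test points, one per stabilizer, therefore detect every
strict inclusion.

Uniform Artin–Rees: let `J` be the ideal of an orbit and `δ` an equivariant field that is Euler-like
there. One polynomial `P` annihilates the lift on `N / J N` for all submodules `N`, and the lift on
`J^k M / J^(k+1) M` is annihilated by `P` shifted by `k`. For large `k` the shifted roots avoid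
those of `P`, whence `J^k M ∩ N ⊆ J N` with `k` independent of `N` (`exists_pow_inf_le`).

Together these embed the lattice of submodules, strictly monotonically, in a finite product of
submodule lattices of Artinian modules `M / J^k M`. -/

theorem derivation_sum_apply {ι κ : Type*} (t : Finset κ)
    (δ : κ → Derivation ℂ (MvPolynomial ι ℂ) (MvPolynomial ι ℂ)) (p : MvPolynomial ι ℂ) :
    (∑ k ∈ t, δ k) p = ∑ k ∈ t, δ k p := by
  have := map_sum (Derivation.coeFnAddMonoidHom (R := ℂ) (A := MvPolynomial ι ℂ)
    (M := MvPolynomial ι ℂ)) δ t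
  have h := congrFun this p
  rw [Finset.sum_apply] at h
  exact h

/-! ### Finite linear groups with a family of reflections -/

/-- A finite-dimensional representation of `G` by matrices, with a family of elements of `G` acting
by the reflections `1 - κ a aᵀ`, and a parameter for each of them. -/
structure ReflectionDatum (ι G S : Type*) [Fintype ι] [DecidableEq ι] [Group G] where
  mat : G →* Matrix ι ι ℂ
  refl : S → G
  refl_inv : ∀ s, (refl s)⁻¹ = refl s
  root : S → ι → ℂ
  scale : S → ℂ
  param : S → ℂ
  mat_refl : ∀ s i j, mat (refl s) i j = (if i = j then 1 else 0) - scale s * root s i * root s j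
  scale_root : ∀ s, scale s * ∑ i, root s i * root s i = 2

namespace ReflectionDatum

variable {ι G S : Type*} [Fintype ι] [DecidableEq ι] [Group G] (𝒟 : ReflectionDatum ι G S)

/-- The action of `G` on polynomials by linear substitutions. -/
def subst (g : G) : MvPolynomial ι ℂ →ₐ[ℂ] MvPolynomial ι ℂ :=
  aeval fun j => ∑ i, C (𝒟.mat g i j) * X i

@[simp] theorem subst_X (g : G) (j : ι) : 𝒟.subst g (X j) = ∑ i, C (𝒟.mat g i j) * X i := by
  simp [subst]

theorem subst_mul (g h : G) : 𝒟.subst (g * h) = (𝒟.subst g).comp (𝒟.subst h) := by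
  apply MvPolynomial.algHom_ext
  intro j
  simp only [subst_X, AlgHom.comp_apply, map_sum, map_mul, Matrix.mul_apply, Finset.sum_mul,
    Finset.mul_sum, MvPolynomial.algHom_C, algebraMap_eq]
  rw [Finset.sum_comm]
  refine Finset.sum_congr rfl fun k _ => Finset.sum_congr rfl fun i _ => ?_
  ring

theorem subst_mul_apply (g h : G) (p : MvPolynomial ι ℂ) :
    𝒟.subst (g * h) p = 𝒟.subst g (𝒟.subst h p) := by
  rw [subst_mul]; rfl

@[simp] theorem subst_one : 𝒟.subst 1 = AlgHom.id ℂ _ := by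
  apply MvPolynomial.algHom_ext
  intro j
  simp [Matrix.one_apply]

@[simp] theorem subst_subst_inv (g : G) (p : MvPolynomial ι ℂ) :
    𝒟.subst g (𝒟.subst g⁻¹ p) = p := by
  rw [← subst_mul_apply]; simp

/-- The action of `G`, from the right, on points. -/
def move (b : ι → ℂ) (g : G) : ι → ℂ := Matrix.vecMul b (𝒟.mat g)

theorem move_mul (b : ι → ℂ) (g h : G) : 𝒟.move b (g * h) = 𝒟.move (𝒟.move b g) h := by
  simp [move, Matrix.vecMul_vecMul]

@[simp] theorem move_one (b : ι → ℂ) : 𝒟.move b 1 = b := by simp [move]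

theorem eval_subst (b : ι → ℂ) (g : G) (p : MvPolynomial ι ℂ) :
    eval b (𝒟.subst g p) = eval (𝒟.move b g) p := by
  have : ((aeval b : MvPolynomial ι ℂ →ₐ[ℂ] ℂ).comp (𝒟.subst g)) = aeval (𝒟.move b g) := by
    apply MvPolynomial.algHom_ext
    intro j
    simp [move, Matrix.vecMul, dotProduct, mul_comm]
  have h := DFunLike.congr_fun this p
  simpa [aeval_eq_eval] using h

/-- The linear form attached to a root. -/
def rootPoly (s : S) : MvPolynomial ι ℂ := ∑ i, C (𝒟.root s i) * X i

theorem subst_refl_X (s : S) (j : ι) :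
    𝒟.subst (𝒟.refl s) (X j) = X j - C (𝒟.scale s * 𝒟.root s j) * 𝒟.rootPoly s := by
  have h : ∀ i, C (𝒟.mat (𝒟.refl s) i j) * X i = (if i = j then X i else 0)
      - C (𝒟.scale s * 𝒟.root s j) * (C (𝒟.root s i) * X i : MvPolynomial ι ℂ) := by
    intro i
    rw [mat_refl]
    split_ifs
    · simp only [C_sub, C_mul, C_1]; ring
    · simp only [C_sub, C_mul, C_0]; ring
  rw [subst_X, Finset.sum_congr rfl fun i _ => h i, Finset.sum_sub_distrib, rootPoly,
    Finset.mul_sum]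
  simp

theorem subst_refl_rootPoly (s : S) :
    𝒟.subst (𝒟.refl s) (𝒟.rootPoly s) = - 𝒟.rootPoly s := by
  have h1 : ∀ i, 𝒟.subst (𝒟.refl s) (C (𝒟.root s i) * X i) = C (𝒟.root s i) * X i
      - C (𝒟.scale s) * C (𝒟.root s i * 𝒟.root s i) * 𝒟.rootPoly s := by
    intro i
    rw [map_mul, subst_refl_X, MvPolynomial.algHom_C, algebraMap_eq, C_mul, C_mul]
    ring
  have h : 𝒟.subst (𝒟.refl s) (𝒟.rootPoly s) = 𝒟.rootPoly s
      - C (𝒟.scale s * ∑ i, 𝒟.root s i * 𝒟.root s i) * 𝒟.rootPoly s := by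
    conv_lhs => rw [rootPoly, map_sum]
    rw [Finset.sum_congr rfl fun i _ => h1 i, Finset.sum_sub_distrib, ← Finset.sum_mul,
      ← Finset.mul_sum, C_mul, map_sum C, ← rootPoly]
  rw [h, scale_root, map_ofNat]
  ring

/-- The reflection moves each coordinate by a multiple of the root, and `p ↦ p - s p` obeys a
twisted Leibniz rule, so induction on `p` suffices. -/
theorem rootPoly_dvd_sub_subst (s : S) (p : MvPolynomial ι ℂ) :
    𝒟.rootPoly s ∣ p - 𝒟.subst (𝒟.refl s) p := by
  induction p using MvPolynomial.induction_on with
  | C a => simp [algebraMap_eq]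
  | add p q hp hq =>
    rw [map_add, add_sub_add_comm]
    exact dvd_add hp hq
  | mul_X p i hp =>
    have : p * X i - 𝒟.subst (𝒟.refl s) (p * X i) = (p - 𝒟.subst (𝒟.refl s) p) * X i
        + 𝒟.subst (𝒟.refl s) p * C (𝒟.scale s * 𝒟.root s i) * 𝒟.rootPoly s := by
      rw [map_mul, subst_refl_X]; ring
    rw [this]
    exact dvd_add (Dvd.dvd.mul_right hp _) (Dvd.intro_left _ rfl)

/-! ### Equivariant derivations -/

/-- Derivations commuting with the action of `G`. -/
def IsEquivariant (δ : Derivation ℂ (MvPolynomial ι ℂ) (MvPolynomial ι ℂ)) : Prop :=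
  ∀ g p, 𝒟.subst g (δ p) = δ (𝒟.subst g p)

variable {𝒟} in
-- Since `s` negates the root `a`, equivariance gives `s (δ a) = - δ a`, and `δ a - s (δ a) = 2 δ a`
-- is divisible by `a`. The quotient is the coefficient of `s` in the lift of `δ`.
theorem IsEquivariant.rootPoly_dvd {δ : Derivation ℂ (MvPolynomial ι ℂ) (MvPolynomial ι ℂ)}
    (hδ : 𝒟.IsEquivariant δ) (s : S) : 𝒟.rootPoly s ∣ δ (𝒟.rootPoly s) := by
  have h := 𝒟.rootPoly_dvd_sub_subst s (δ (𝒟.rootPoly s))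
  rw [hδ, subst_refl_rootPoly, map_neg, sub_neg_eq_add] at h
  have h2 : δ (𝒟.rootPoly s) = C (1 / 2 : ℂ) * (δ (𝒟.rootPoly s) + δ (𝒟.rootPoly s)) := by
    rw [← two_mul, ← mul_assoc, ← map_ofNat C 2, ← C_mul]
    norm_num
  rw [h2]
  exact Dvd.dvd.mul_left h _

/-- The conjugate of a derivation by an element of `G`. -/
def conj (g : G) (δ : Derivation ℂ (MvPolynomial ι ℂ) (MvPolynomial ι ℂ)) :
    Derivation ℂ (MvPolynomial ι ℂ) (MvPolynomial ι ℂ) :=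
  Derivation.mk' ((𝒟.subst g).toLinearMap ∘ₗ δ.toLinearMap ∘ₗ (𝒟.subst g⁻¹).toLinearMap) <| by
    intro p q
    simp

@[simp] theorem conj_apply (g : G) (δ : Derivation ℂ (MvPolynomial ι ℂ) (MvPolynomial ι ℂ))
    (p : MvPolynomial ι ℂ) : 𝒟.conj g δ p = 𝒟.subst g (δ (𝒟.subst g⁻¹ p)) := rfl

theorem isEquivariant_sum_conj [Fintype G]
    (δ : Derivation ℂ (MvPolynomial ι ℂ) (MvPolynomial ι ℂ)) :
    𝒟.IsEquivariant (∑ g, 𝒟.conj g δ) := by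
  intro g p
  simp only [derivation_sum_apply, conj_apply, map_sum, ← subst_mul_apply]
  refine Fintype.sum_equiv (Equiv.mulLeft g) _ _ fun h => ?_
  simp

variable {𝒟} in
theorem IsEquivariant.smul {δ : Derivation ℂ (MvPolynomial ι ℂ) (MvPolynomial ι ℂ)}
    (hδ : 𝒟.IsEquivariant δ) (a : ℂ) : 𝒟.IsEquivariant (a • δ) := by
  intro g p
  simp [hδ g p]

end ReflectionDatum

/-! ### Points and derivations -/

section Points

variable {ι : Type*}

/-- The maximal ideal of polynomials vanishing at a point. -/
def pointIdeal (b : ι → ℂ) : Ideal (MvPolynomial ι ℂ) := RingHom.ker (eval b)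

theorem mem_pointIdeal {b : ι → ℂ} {p : MvPolynomial ι ℂ} : p ∈ pointIdeal b ↔ eval b p = 0 :=
  Iff.rfl

instance (b : ι → ℂ) : (pointIdeal b).IsMaximal :=
  RingHom.ker_isMaximal_of_surjective _ fun z => ⟨C z, by simp⟩

theorem X_sub_C_mem_pointIdeal (b : ι → ℂ) (i : ι) : X i - C (b i) ∈ pointIdeal b := by
  simp [mem_pointIdeal]

theorem pointIdeal_eq_span (b : ι → ℂ) :
    pointIdeal b = Ideal.span (Set.range fun i => X i - C (b i)) := by
  refine le_antisymm (fun p hp => ?_) (Ideal.span_le.2 ?_)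
  · have key : ∀ q : MvPolynomial ι ℂ,
        q - C (eval b q) ∈ Ideal.span (Set.range fun i => X i - C (b i)) := by
      intro q
      induction q using MvPolynomial.induction_on with
      | C a => simp
      | add p q hp hq =>
        rw [map_add, C_add, add_sub_add_comm]
        exact add_mem hp hq
      | mul_X p i hp =>
        have : p * X i - C (eval b (p * X i)) =
            X i * (p - C (eval b p)) + C (eval b p) * (X i - C (b i)) := by
          simp only [map_mul, eval_X]; ring
        rw [this]
        exact add_mem (Ideal.mul_mem_left _ _ hp)
          (Ideal.mul_mem_left _ _ (Ideal.subset_span ⟨i, rfl⟩))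
    have := key p
    rwa [mem_pointIdeal.1 hp, C_0, sub_zero] at this
  · rintro _ ⟨i, rfl⟩
    exact X_sub_C_mem_pointIdeal b i

theorem pointIdeal_injective : Function.Injective (pointIdeal (ι := ι)) := by
  intro b b' h
  funext i
  have := X_sub_C_mem_pointIdeal b i
  rw [h, mem_pointIdeal] at this
  simpa [sub_eq_zero, eq_comm] using this

theorem isCoprime_pointIdeal {b b' : ι → ℂ} (h : b ≠ b') :
    IsCoprime (pointIdeal b) (pointIdeal b') :=
  Ideal.isCoprime_of_isMaximal (pointIdeal_injective.ne h)

/-- The Nullstellensatz over `ℂ`: maximal ideals are points. -/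
theorem exists_le_pointIdeal [Finite ι] {I : Ideal (MvPolynomial ι ℂ)} (hI : I ≠ ⊤) :
    ∃ b, I ≤ pointIdeal b := by
  obtain ⟨m, hm, hIm⟩ := Ideal.exists_le_maximal I hI
  obtain ⟨b, rfl⟩ := (isMaximal_iff_eq_vanishingIdeal_singleton (K := ℂ)).1 hm
  refine ⟨b, fun p hp => ?_⟩
  have := (mem_vanishingIdeal_singleton_iff b p).1 (hIm hp)
  simpa [mem_pointIdeal, aeval_eq_eval] using this

/-- A derivation whose coefficients lie in an ideal has all its values in it. -/
theorem derivation_mem {δ : Derivation ℂ (MvPolynomial ι ℂ) (MvPolynomial ι ℂ)}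
    {I : Ideal (MvPolynomial ι ℂ)} (h : ∀ i, δ (X i) ∈ I) (p : MvPolynomial ι ℂ) : δ p ∈ I := by
  induction p using MvPolynomial.induction_on with
  | C a => simp [← algebraMap_eq]
  | add p q hp hq => rw [map_add]; exact add_mem hp hq
  | mul_X p i hp =>
    rw [Derivation.leibniz, smul_eq_mul, smul_eq_mul]
    exact add_mem (Ideal.mul_mem_left _ _ (h i)) (Ideal.mul_mem_left _ _ hp)

/-- A derivation which is the identity on `J / (J ^ 2 + 𝔭)` and maps `R` to `J + 𝔭` is
multiplication by `k` on `J ^ k / (J ^ (k + 1) + 𝔭)`. -/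
theorem derivation_pow_sub_mem {R : Type*} [CommRing R] [Algebra ℂ R] {δ : Derivation ℂ R R}
    {J 𝔭 : Ideal R} (hδ' : ∀ p, δ p ∈ J ⊔ 𝔭) (hδ : ∀ p ∈ J, δ p - p ∈ J ^ 2 ⊔ 𝔭) (k : ℕ) :
    ∀ p ∈ J ^ k, δ p - (k : R) * p ∈ J ^ (k + 1) ⊔ 𝔭 := by
  have hmul : ∀ {m n : ℕ} {p q : R}, p ∈ J ^ m → q ∈ J ^ n ⊔ 𝔭 → p * q ∈ J ^ (m + n) ⊔ 𝔭 := by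
    intro m n p q hp hq
    obtain ⟨u, hu, v, hv, rfl⟩ := Submodule.mem_sup.1 hq
    rw [mul_add, pow_add]
    exact Submodule.add_mem_sup (Ideal.mul_mem_mul hp hu) (Ideal.mul_mem_left _ _ hv)
  induction k with
  | zero => intro p _; simpa using hδ' p
  | succ k ih =>
    intro p hp
    rw [pow_succ] at hp
    refine Submodule.mul_induction_on hp (fun a ha b hb => ?_) fun a b ha hb => ?_
    · have h1 : a * (δ b - b) ∈ J ^ (k + 1 + 1) ⊔ 𝔭 := by
        simpa [add_assoc] using hmul ha (hδ b hb)
      have h2 : b * (δ a - (k : R) * a) ∈ J ^ (k + 1 + 1) ⊔ 𝔭 := by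
        have := hmul (m := 1) (p := b) (by simpa using hb) (ih a ha)
        rwa [add_comm 1] at this
      have : δ (a * b) - ((k + 1 : ℕ) : R) * (a * b) =
          a * (δ b - b) + b * (δ a - (k : R) * a) := by
        rw [Derivation.leibniz, smul_eq_mul, smul_eq_mul]; push_cast; ring
      rw [this]
      exact add_mem h1 h2
    · have : δ (a + b) - ((k + 1 : ℕ) : R) * (a + b) = (δ a - ((k + 1 : ℕ) : R) * a) +
          (δ b - ((k + 1 : ℕ) : R) * b) := by rw [map_add]; ring
      rw [this]
      exact add_mem ha hb

/-- By the Leibniz rule it is enough to test the Euler condition at `b` on the generators `X i - b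
i`; the result is the input of `derivation_pow_sub_mem`. -/
theorem derivation_sub_mem_of_X {δ : Derivation ℂ (MvPolynomial ι ℂ) (MvPolynomial ι ℂ)}
    {b : ι → ℂ} {𝔭 : Ideal (MvPolynomial ι ℂ)}
    (hδ : ∀ i, δ (X i) - (X i - C (b i)) ∈ pointIdeal b ^ 2 ⊔ 𝔭) :
    (∀ p, δ p ∈ pointIdeal b ⊔ 𝔭) ∧
      ∀ p ∈ pointIdeal b, δ p - p ∈ pointIdeal b ^ 2 ⊔ 𝔭 := by
  have hle : pointIdeal b ^ 2 ⊔ 𝔭 ≤ pointIdeal b ⊔ 𝔭 :=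
    sup_le_sup_right (Ideal.pow_le_self two_ne_zero) _
  have h1 : ∀ p, δ p ∈ pointIdeal b ⊔ 𝔭 := by
    refine derivation_mem fun i => ?_
    have := add_mem (hle (hδ i))
      (Ideal.mem_sup_left (X_sub_C_mem_pointIdeal b i) : _ ∈ pointIdeal b ⊔ 𝔭)
    simpa using this
  refine ⟨h1, fun p hp => ?_⟩
  rw [pointIdeal_eq_span] at hp
  refine Submodule.span_induction ?_ ?_ ?_ ?_ hp
  · rintro _ ⟨i, rfl⟩
    have hC : δ (C (b i)) = 0 := by simp [← algebraMap_eq]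
    simpa [hC] using hδ i
  · simp
  · intro x y _ _ hx hy
    rw [map_add, add_sub_add_comm]
    exact add_mem hx hy
  · intro r x hx hx'
    change x ∈ Ideal.span _ at hx
    rw [← pointIdeal_eq_span] at hx
    have : δ (r • x) - r • x = x * δ r + r * (δ x - x) := by
      simp only [smul_eq_mul, Derivation.leibniz]; ring
    rw [this]
    refine add_mem ?_ (Ideal.mul_mem_left _ _ hx')
    obtain ⟨u, hu, v, hv, huv⟩ := Submodule.mem_sup.1 (h1 r)
    rw [← huv, mul_add, pow_two]
    exact Submodule.add_mem_sup (Ideal.mul_mem_mul hx hu) (Ideal.mul_mem_left _ _ hv)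

end Points

end RationalCherednik

/-! ### Orbits, stabilizers and equivariant vector fields. -/

namespace RationalCherednik

open MvPolynomial

namespace ReflectionDatum

variable {ι G S : Type*} [Fintype ι] [DecidableEq ι] [Group G] (𝒟 : ReflectionDatum ι G S)

theorem subst_mem_pointIdeal_pow {b : ι → ℂ} {g : G} {k : ℕ} {p : MvPolynomial ι ℂ}
    (hp : p ∈ pointIdeal (𝒟.move b g) ^ k) : 𝒟.subst g p ∈ pointIdeal b ^ k := by
  have h : (pointIdeal (𝒟.move b g)).map (𝒟.subst g) ≤ pointIdeal b := by
    rw [Ideal.map_le_iff_le_comap]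
    intro q hq
    rw [Ideal.mem_comap, mem_pointIdeal, eval_subst]
    exact hq
  have h2 := Ideal.pow_right_mono h k
  rw [← Ideal.map_pow] at h2
  exact h2 (Ideal.mem_map_of_mem _ hp)

section Orbit

variable [Fintype G]

open Classical in
/-- The orbit of a point. -/
def orbit (b : ι → ℂ) : Finset (ι → ℂ) := Finset.univ.image (𝒟.move b)

theorem mem_orbit {b q : ι → ℂ} : q ∈ 𝒟.orbit b ↔ ∃ g, 𝒟.move b g = q := by
  simp [orbit]

theorem self_mem_orbit (b : ι → ℂ) : b ∈ 𝒟.orbit b := 𝒟.mem_orbit.2 ⟨1, by simp⟩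

theorem move_mem_orbit {b q : ι → ℂ} (hq : q ∈ 𝒟.orbit b) (g : G) : 𝒟.move q g ∈ 𝒟.orbit b := by
  obtain ⟨h, rfl⟩ := 𝒟.mem_orbit.1 hq
  exact 𝒟.mem_orbit.2 ⟨h * g, 𝒟.move_mul _ _ _⟩

/-- The radical ideal of an orbit. -/
def orbitIdeal (b : ι → ℂ) : Ideal (MvPolynomial ι ℂ) := ∏ q ∈ 𝒟.orbit b, pointIdeal q

/-- Ideals of distinct points, and their powers, are coprime, so the product is an intersection and
membership is tested point by point. -/
theorem orbitIdeal_pow (b : ι → ℂ) (k : ℕ) :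
    𝒟.orbitIdeal b ^ k = ⨅ q ∈ 𝒟.orbit b, pointIdeal q ^ k := by
  rw [orbitIdeal, ← Finset.prod_pow, Ideal.prod_eq_iInf_of_pairwise_isCoprime]
  exact fun i _ j _ hij => (isCoprime_pointIdeal hij).pow

theorem mem_orbitIdeal_pow {b : ι → ℂ} {k : ℕ} {p : MvPolynomial ι ℂ} :
    p ∈ 𝒟.orbitIdeal b ^ k ↔ ∀ q ∈ 𝒟.orbit b, p ∈ pointIdeal q ^ k := by
  simp [orbitIdeal_pow]

theorem mem_orbitIdeal {b : ι → ℂ} {p : MvPolynomial ι ℂ} :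
    p ∈ 𝒟.orbitIdeal b ↔ ∀ q ∈ 𝒟.orbit b, eval q p = 0 := by
  simpa [mem_pointIdeal] using 𝒟.mem_orbitIdeal_pow (b := b) (k := 1) (p := p)

theorem orbitIdeal_le (b : ι → ℂ) : 𝒟.orbitIdeal b ≤ pointIdeal b :=
  fun _ hp => 𝒟.mem_orbitIdeal.1 hp b (𝒟.self_mem_orbit b)

/-- There is an equivariant vector field which, at every point of an orbit, vanishes and has the
identity as its linear part. -/
theorem exists_equivariant_euler (b : ι → ℂ) :
    ∃ δ : Derivation ℂ (MvPolynomial ι ℂ) (MvPolynomial ι ℂ), 𝒟.IsEquivariant δ ∧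
      (∀ p, δ p ∈ 𝒟.orbitIdeal b) ∧ ∀ p ∈ 𝒟.orbitIdeal b, δ p - p ∈ 𝒟.orbitIdeal b ^ 2 := by
  -- Chinese remainder theorem: a vector field with Euler 1-jet at every orbit point at once.
  -- Conjugation permutes these jets, so averaging over `G` keeps them.
  have hF : ∀ i, ∃ F : MvPolynomial ι ℂ, ∀ q ∈ 𝒟.orbit b,
      F - (X i - C (q i)) ∈ pointIdeal q ^ 2 := by
    intro i
    obtain ⟨F, hF⟩ := Ideal.exists_forall_sub_mem_ideal
      (I := fun q : 𝒟.orbit b => pointIdeal q.1 ^ 2)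
      (fun q q' hq => (isCoprime_pointIdeal (Subtype.coe_injective.ne hq)).pow)
      fun q => X i - C (q.1 i)
    exact ⟨F, fun q hq => hF ⟨q, hq⟩⟩
  choose F hF using hF
  set δ₀ := mkDerivation ℂ F with hδ₀
  have h₀ : ∀ q ∈ 𝒟.orbit b, (∀ p, δ₀ p ∈ pointIdeal q) ∧
      ∀ p ∈ pointIdeal q, δ₀ p - p ∈ pointIdeal q ^ 2 := by
    intro q hq
    have := derivation_sub_mem_of_X (δ := δ₀) (b := q) (𝔭 := ⊥) fun i => by
      simpa [hδ₀, mkDerivation_X] using hF i q hq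
    simpa using this
  have hconj : ∀ q ∈ 𝒟.orbit b, ∀ g, (∀ p, 𝒟.conj g δ₀ p ∈ pointIdeal q) ∧
      ∀ p ∈ pointIdeal q, 𝒟.conj g δ₀ p - p ∈ pointIdeal q ^ 2 := by
    intro q hq g
    have hq' := h₀ _ (𝒟.move_mem_orbit hq g)
    refine ⟨fun p => ?_, fun p hp => ?_⟩
    · simpa using 𝒟.subst_mem_pointIdeal_pow (k := 1) (by simpa using hq'.1 (𝒟.subst g⁻¹ p))
    · have hp' : 𝒟.subst g⁻¹ p ∈ pointIdeal (𝒟.move q g) := by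
        rw [mem_pointIdeal, eval_subst, ← move_mul]
        simpa [mem_pointIdeal] using hp
      have := 𝒟.subst_mem_pointIdeal_pow (hq'.2 _ hp')
      simpa using this
  have hcard : (Fintype.card G : ℂ) ≠ 0 := by simp
  refine ⟨((Fintype.card G : ℂ)⁻¹) • ∑ g, 𝒟.conj g δ₀, (𝒟.isEquivariant_sum_conj δ₀).smul _,
    fun p => ?_, fun p hp => ?_⟩
  · rw [← pow_one (𝒟.orbitIdeal b), mem_orbitIdeal_pow]
    intro q hq
    rw [pow_one, Derivation.smul_apply, derivation_sum_apply, smul_eq_C_mul]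
    exact Ideal.mul_mem_left _ _ (sum_mem fun g _ => (hconj q hq g).1 p)
  · rw [mem_orbitIdeal_pow]
    intro q hq
    have hpq : p ∈ pointIdeal q := 𝒟.mem_orbitIdeal.1 hp q hq
    have : ((Fintype.card G : ℂ)⁻¹ • ∑ g, 𝒟.conj g δ₀) p - p =
        C (Fintype.card G : ℂ)⁻¹ * ∑ g, (𝒟.conj g δ₀ p - p) := by
      rw [Derivation.smul_apply, derivation_sum_apply, smul_eq_C_mul, Finset.sum_sub_distrib,
        mul_sub, Finset.sum_const, Finset.card_univ, nsmul_eq_mul, ← mul_assoc,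
        ← map_natCast C, ← C_mul, inv_mul_cancel₀ hcard, C_1, one_mul]
    rw [this]
    exact Ideal.mul_mem_left _ _ (sum_mem fun g _ => (hconj q hq g).2 p hpq)

open Classical in
/-- The stabilizer of a point, as a finite set. -/
def stab (b : ι → ℂ) : Finset G := {g | 𝒟.move b g = b}

theorem mem_stab {b : ι → ℂ} {g : G} : g ∈ 𝒟.stab b ↔ 𝒟.move b g = b := by simp [stab]

theorem inv_mem_stab {b : ι → ℂ} {g : G} (hg : g ∈ 𝒟.stab b) : g⁻¹ ∈ 𝒟.stab b := by
  rw [mem_stab] at hg ⊢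
  conv_lhs => rw [← hg]
  rw [← move_mul]; simp

theorem card_stab_ne_zero (b : ι → ℂ) : ((𝒟.stab b).card : ℂ) ≠ 0 := by
  rw [Nat.cast_ne_zero]
  exact Finset.card_ne_zero_of_mem (𝒟.mem_stab.2 (𝒟.move_one b))

/-- The projection to the space of points fixed by the stabilizer of `b`. -/
def fixProj (b : ι → ℂ) (i j : ι) : ℂ :=
  ((𝒟.stab b).card : ℂ)⁻¹ * ∑ h ∈ 𝒟.stab b, 𝒟.mat h⁻¹ i j

/-- There are equivariant vector fields with any prescribed value, fixed by the stabilizer, at a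
point. -/
theorem exists_equivariant_value (b : ι → ℂ) (i : ι) :
    ∃ δ : Derivation ℂ (MvPolynomial ι ℂ) (MvPolynomial ι ℂ), 𝒟.IsEquivariant δ ∧
      ∀ j, δ (X j) - C (𝒟.fixProj b i j) ∈ pointIdeal b := by
  classical
  -- A bump function on the orbit, 1 at `b` and 0 elsewhere. In the conjugates of `q ∂_i`, evaluated
  -- at `b`, only the stabilizer of `b` contributes, and it averages `∂_i` to its fixed part.
  obtain ⟨q, hq⟩ := Ideal.exists_forall_sub_mem_ideal
    (I := fun q : 𝒟.orbit b => pointIdeal q.1)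
    (fun q q' hq => isCoprime_pointIdeal (Subtype.coe_injective.ne hq))
    fun q => if q.1 = b then 1 else 0
  have hq' : ∀ g, eval (𝒟.move b g) q = if 𝒟.move b g = b then 1 else 0 := by
    intro g
    have := hq ⟨_, 𝒟.move_mem_orbit (𝒟.self_mem_orbit b) g⟩
    rw [mem_pointIdeal, map_sub, sub_eq_zero] at this
    rw [this]
    split_ifs <;> simp
  refine ⟨((𝒟.stab b).card : ℂ)⁻¹ • ∑ g, 𝒟.conj g (q • pderiv i),
    (𝒟.isEquivariant_sum_conj _).smul _, fun j => ?_⟩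
  have h1 : ∀ g, 𝒟.conj g (q • pderiv i) (X j) = 𝒟.subst g q * C (𝒟.mat g⁻¹ i j) := by
    intro g
    have : pderiv i (∑ k, C (𝒟.mat g⁻¹ k j) * X k) = C (𝒟.mat g⁻¹ i j) := by
      rw [map_sum, Finset.sum_eq_single i]
      · simp
      · intro k _ hk
        simp [pderiv_X_of_ne hk]
      · simp
    rw [conj_apply, subst_X, Derivation.smul_apply, this, smul_eq_mul, map_mul,
      MvPolynomial.algHom_C, algebraMap_eq]
  rw [mem_pointIdeal, map_sub, Derivation.smul_apply, derivation_sum_apply, smul_eq_C_mul, map_mul,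
    eval_C, eval_C, fixProj, sub_eq_zero]
  congr 1
  rw [map_sum, stab, Finset.sum_filter]
  refine Finset.sum_congr rfl fun g _ => ?_
  rw [h1, map_mul, eval_subst, hq', eval_C]
  split_ifs <;> simp

/-- An ideal stable under the equivariant derivations which vanishes at a point `b` vanishes at all
points fixed by the stabilizer of `b`. -/
theorem le_pointIdeal_of_stable {I : Ideal (MvPolynomial ι ℂ)}
    (hI : ∀ δ, 𝒟.IsEquivariant δ → ∀ p ∈ I, δ p ∈ I) {b b' : ι → ℂ} (hb : I ≤ pointIdeal b)
    (hb' : 𝒟.stab b ⊆ 𝒟.stab b') : I ≤ pointIdeal b' := by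
  choose δ hδ hδX using 𝒟.exists_equivariant_value b
  -- The ideal cutting out the points fixed by the stabilizer of `b`; equivariant derivations
  -- preserve it.
  set 𝔭 : Ideal (MvPolynomial ι ℂ) :=
    Ideal.span {p | ∃ h ∈ 𝒟.stab b, ∃ r, p = 𝒟.subst h r - r} with h𝔭
  -- An Euler field at `b` along the fixed locus: modulo `𝔭`, each coordinate difference equals its
  -- average over the stabilizer.
  set ε : Derivation ℂ (MvPolynomial ι ℂ) (MvPolynomial ι ℂ) :=
    ∑ i, (X i - C (b i) : MvPolynomial ι ℂ) • δ i with hε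
  have hεa : ∀ p, ε p = ∑ i, (X i - C (b i)) * δ i p := by
    intro p
    rw [hε, derivation_sum_apply]
    rfl
  have hδ𝔭 : ∀ i, ∀ p ∈ 𝔭, δ i p ∈ 𝔭 := by
    intro i p hp
    refine Submodule.span_induction ?_ ?_ ?_ ?_ hp
    · rintro _ ⟨h, hh, r, rfl⟩
      rw [map_sub, ← hδ i h r]
      exact Ideal.subset_span ⟨h, hh, _, rfl⟩
    · simp
    · intro x y _ _ hx hy
      rw [map_add]; exact add_mem hx hy
    · intro r x hx hx'
      rw [smul_eq_mul, Derivation.leibniz]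
      exact add_mem (Ideal.mul_mem_left _ _ hx') (Ideal.mul_mem_right _ _ hx)
  have hεX : ∀ j, ε (X j) - (X j - C (b j)) ∈ pointIdeal b ^ 2 ⊔ 𝔭 := by
    intro j
    have e1 : ∑ i, (X i - C (b i)) * C (𝒟.fixProj b i j) - (X j - C (b j)) =
        C ((𝒟.stab b).card : ℂ)⁻¹ * ∑ h ∈ 𝒟.stab b, (𝒟.subst h⁻¹ (X j) - X j) := by
      have e2 : ∀ h ∈ 𝒟.stab b, 𝒟.subst h⁻¹ (X j) - X j =
          ∑ i, (X i - C (b i)) * C (𝒟.mat h⁻¹ i j) - (X j - C (b j)) := by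
        intro h hh
        have e3 : ∑ i, b i * 𝒟.mat h⁻¹ i j = b j := by
          have := congrFun (𝒟.mem_stab.1 (𝒟.inv_mem_stab hh)) j
          simpa [move, Matrix.vecMul, dotProduct] using this
        rw [subst_X]
        conv_lhs => rw [← sub_sub_sub_cancel_right _ _ (C (b j))]
        congr 1
        conv_lhs => rw [← e3]
        rw [map_sum, ← Finset.sum_sub_distrib]
        refine Finset.sum_congr rfl fun i _ => ?_
        rw [C_mul]; ring
      rw [Finset.sum_congr rfl e2, Finset.sum_sub_distrib, Finset.sum_const, mul_sub, nsmul_eq_mul,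
        ← mul_assoc, ← map_natCast C, ← C_mul, inv_mul_cancel₀ (𝒟.card_stab_ne_zero b), C_1,
        one_mul, Finset.sum_comm, Finset.mul_sum]
      congr 1
      refine Finset.sum_congr rfl fun i _ => ?_
      rw [fixProj, C_mul, map_sum, ← Finset.mul_sum]
      ring
    have e4 : ε (X j) - (X j - C (b j)) =
        ∑ i, (X i - C (b i)) * (δ i (X j) - C (𝒟.fixProj b i j)) +
          (∑ i, (X i - C (b i)) * C (𝒟.fixProj b i j) - (X j - C (b j))) := by
      rw [hεa, ← add_sub_assoc, ← Finset.sum_add_distrib]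
      congr 1
      refine Finset.sum_congr rfl fun i _ => ?_
      ring
    rw [e4, e1, pow_two]
    refine Submodule.add_mem_sup
      (sum_mem fun i _ => Ideal.mul_mem_mul (X_sub_C_mem_pointIdeal b i) (hδX i j))
      (Ideal.mul_mem_left _ _ (sum_mem fun h hh =>
        Ideal.subset_span ⟨h⁻¹, 𝒟.inv_mem_stab hh, _, rfl⟩))
  have hεprop := derivation_sub_mem_of_X hεX
  -- If all `δ i p` vanish to order `k + 1` on the fixed locus, then `ε p` vanishes to order `k +
  -- 2`; but `ε` multiplies the leading term of `p` by `k + 1 ≠ 0`, so that term is zero.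
  have key : ∀ k : ℕ, I ≤ pointIdeal b ^ (k + 1) ⊔ 𝔭 := by
    intro k
    induction k with
    | zero => simpa using le_sup_of_le_left hb
    | succ k ih =>
      intro p hp
      have h1 : ε p ∈ pointIdeal b ^ (k + 1 + 1) ⊔ 𝔭 := by
        rw [hεa]
        refine sum_mem fun i _ => ?_
        obtain ⟨u, hu, v, hv, huv⟩ := Submodule.mem_sup.1 (ih (hI _ (hδ i) p hp))
        rw [← huv, mul_add, pow_succ' _ (k + 1)]
        exact Submodule.add_mem_sup (Ideal.mul_mem_mul (X_sub_C_mem_pointIdeal b i) hu)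
          (Ideal.mul_mem_left _ _ hv)
      obtain ⟨a, ha, v, hv, rfl⟩ := Submodule.mem_sup.1 (ih hp)
      have h2 := derivation_pow_sub_mem hεprop.1 hεprop.2 (k + 1) a ha
      have h3 : ε v ∈ 𝔭 := by
        rw [hεa]
        exact sum_mem fun i _ => Ideal.mul_mem_left _ _ (hδ𝔭 i v hv)
      have h4 : C ((k + 1 : ℕ) : ℂ) * a ∈ pointIdeal b ^ (k + 1 + 1) ⊔ 𝔭 := by
        have := sub_mem (sub_mem h1 (Ideal.mem_sup_right h3)) h2
        rw [map_add] at this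
        convert this using 1
        rw [map_natCast]; ring
      refine add_mem ?_ (Ideal.mem_sup_right hv)
      have h5 := Ideal.mul_mem_left _ (C ((k + 1 : ℕ) : ℂ)⁻¹) h4
      rwa [← mul_assoc, ← C_mul, inv_mul_cancel₀ (Nat.cast_ne_zero.2 (Nat.succ_ne_zero k)), C_1,
        one_mul] at h5
  intro p hp
  -- Restriction to the line from `b` (parameter 0) to `b'` (parameter 1), which lies in the fixed
  -- locus. By `key` an element of `I` vanishes there to infinite order at 0, hence identically.
  set φ : MvPolynomial ι ℂ →ₐ[ℂ] Polynomial ℂ :=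
    aeval fun i => Polynomial.C (b i) + Polynomial.C (b' i - b i) * Polynomial.X with hφ
  have hφ𝔭 : 𝔭 ≤ RingHom.ker φ := by
    rw [h𝔭, Ideal.span_le]
    rintro _ ⟨h, hh, r, rfl⟩
    have e : φ.comp (𝒟.subst h) = φ := by
      apply MvPolynomial.algHom_ext
      intro j
      have e1 : ∑ i, b i * 𝒟.mat h i j = b j := congrFun (𝒟.mem_stab.1 hh) j
      have e2 : ∑ i, b' i * 𝒟.mat h i j = b' j := congrFun (𝒟.mem_stab.1 (hb' hh)) j
      have e3 : ∀ i, φ (C (𝒟.mat h i j) * X i) = Polynomial.C (b i * 𝒟.mat h i j) +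
          (Polynomial.C (b' i * 𝒟.mat h i j) - Polynomial.C (b i * 𝒟.mat h i j)) *
            Polynomial.X := by
        intro i
        simp only [hφ, map_mul, aeval_X, MvPolynomial.algHom_C, Polynomial.algebraMap_eq, map_sub]
        ring
      rw [AlgHom.comp_apply, subst_X, map_sum, Finset.sum_congr rfl fun i _ => e3 i,
        Finset.sum_add_distrib, ← Finset.sum_mul, Finset.sum_sub_distrib, ← map_sum, ← map_sum,
        e1, e2]
      simp [hφ]
    have := DFunLike.congr_fun e r
    rw [AlgHom.comp_apply] at this
    rw [SetLike.mem_coe, RingHom.mem_ker, map_sub, this, sub_self]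
  have hφm : (pointIdeal b).map φ ≤ Ideal.span {Polynomial.X} := by
    rw [pointIdeal_eq_span, Ideal.map_span, Ideal.span_le]
    rintro _ ⟨_, ⟨i, rfl⟩, rfl⟩
    rw [SetLike.mem_coe, Ideal.mem_span_singleton]
    simp [hφ, Polynomial.algebraMap_eq]
  have hφp : φ p = 0 := by
    ext n
    have h1 : (φ p) ∈ Ideal.span {(Polynomial.X : Polynomial ℂ) ^ (n + 1)} := by
      obtain ⟨u, hu, v, hv, huv⟩ := Submodule.mem_sup.1 (key n hp)
      rw [← huv, map_add, (RingHom.mem_ker).1 (hφ𝔭 hv), add_zero, ← Ideal.span_singleton_pow]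
      refine Ideal.pow_right_mono hφm _ ?_
      rw [← Ideal.map_pow]
      exact Ideal.mem_map_of_mem _ hu
    rw [Ideal.mem_span_singleton, Polynomial.X_pow_dvd_iff] at h1
    simpa using h1 n (Nat.lt_succ_self n)
  have hev : ((Polynomial.aeval (1 : ℂ)).comp φ : MvPolynomial ι ℂ →ₐ[ℂ] ℂ) = aeval b' := by
    apply MvPolynomial.algHom_ext
    intro j
    simp [hφ]
  have := DFunLike.congr_fun hev p
  rw [AlgHom.comp_apply, hφp, map_zero, aeval_eq_eval] at this
  exact this.symm

end Orbit

end ReflectionDatum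

end RationalCherednik

namespace RationalCherednik

open MvPolynomial

/-! ### Realizations -/

open scoped IsMulCommutative in
-- As `A` is not commutative, evaluation passes through the subalgebra generated by the `x i`, which
-- is.
theorem exists_algHom_of_commute {ι A : Type*} [Ring A] [Algebra ℂ A] (x : ι → A)
    (hx : ∀ i j, x i * x j = x j * x i) :
    ∃ φ : MvPolynomial ι ℂ →ₐ[ℂ] A, ∀ i, φ (X i) = x i := by
  have hcomm : ∀ a ∈ Set.range x, ∀ b ∈ Set.range x, a * b = b * a := by
    rintro _ ⟨i, rfl⟩ _ ⟨j, rfl⟩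
    exact hx i j
  have := Algebra.isMulCommutative_adjoin ℂ hcomm
  let f : ι → Algebra.adjoin ℂ (Set.range x) := fun i => ⟨x i, Algebra.subset_adjoin ⟨i, rfl⟩⟩
  let ψ : MvPolynomial ι ℂ →ₐ[ℂ] Algebra.adjoin ℂ (Set.range x) := aeval f
  refine ⟨(Algebra.adjoin ℂ (Set.range x)).val.comp ψ, fun i => ?_⟩
  simp [ψ, f]

theorem ReflectionDatum.mul_algHom_eq {ι G S A : Type*} [Fintype ι] [DecidableEq ι] [Group G]
    [Ring A] [Algebra ℂ A] (𝒟 : ReflectionDatum ι G S) {φ : MvPolynomial ι ℂ →ₐ[ℂ] A} {w : A}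
    {g : G}
    (h : ∀ j, w * φ (X j) = ∑ i, 𝒟.mat g i j • (φ (X i) * w)) (p : MvPolynomial ι ℂ) :
    w * φ p = φ (𝒟.subst g p) * w := by
  induction p using MvPolynomial.induction_on with
  | C a => simp [algebraMap_eq, Algebra.commutes]
  | add p q hp hq => rw [map_add, map_add, map_add, mul_add, add_mul, hp, hq]
  | mul_X p j hp =>
    have : w * φ (X j) = φ (𝒟.subst g (X j)) * w := by
      simp [h, Finset.sum_mul, Algebra.smul_def, mul_assoc]
    rw [map_mul, map_mul, map_mul, ← mul_assoc, hp, mul_assoc, this, mul_assoc]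

/-- Elements of an algebra which satisfy the relations of a Cherednik algebra, except those which
concern momenta only. -/
structure Realization {ι G S : Type*} [Fintype ι] [DecidableEq ι] [Group G] [Fintype S]
    (𝒟 : ReflectionDatum ι G S) (A : Type*) [Ring A] [Algebra ℂ A] where
  x : ι → A
  y : ι → A
  w : G →* A
  x_comm : ∀ i j, x i * x j = x j * x i
  w_x : ∀ g j, w g * x j = ∑ i, 𝒟.mat g i j • (x i * w g)
  y_x : ∀ i j, y i * x j - x j * y i = (if i = j then 1 else 0) +
    ∑ s, (𝒟.param s * 𝒟.scale s * 𝒟.root s i * 𝒟.root s j) • w (𝒟.refl s)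

namespace Realization

variable {ι G S : Type*} [Fintype ι] [DecidableEq ι] [Group G] [Fintype S]
  {𝒟 : ReflectionDatum ι G S} {A : Type*} [Ring A] [Algebra ℂ A] (ρ : Realization 𝒟 A)

/-- Polynomials in the coordinates. -/
def poly : MvPolynomial ι ℂ →ₐ[ℂ] A := (exists_algHom_of_commute ρ.x ρ.x_comm).choose

@[simp] theorem poly_X (i : ι) : ρ.poly (X i) = ρ.x i :=
  (exists_algHom_of_commute ρ.x ρ.x_comm).choose_spec i

@[simp] theorem poly_C (a : ℂ) : ρ.poly (C a) = algebraMap ℂ A a := by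
  rw [MvPolynomial.algHom_C]

theorem poly_comm (p q : MvPolynomial ι ℂ) : ρ.poly p * ρ.poly q = ρ.poly q * ρ.poly p := by
  rw [← map_mul, mul_comm, map_mul]

theorem w_poly (g : G) (p : MvPolynomial ι ℂ) :
    ρ.w g * ρ.poly p = ρ.poly (𝒟.subst g p) * ρ.w g :=
  𝒟.mul_algHom_eq (fun j => by simpa using ρ.w_x g j) p

variable {δ : Derivation ℂ (MvPolynomial ι ℂ) (MvPolynomial ι ℂ)} (hδ : 𝒟.IsEquivariant δ)

/-- The part of `lift` which involves no momenta. -/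
def liftGroup : A := ∑ s, 𝒟.param s •
    (ρ.poly (hδ.rootPoly_dvd s).choose * ρ.w (𝒟.refl s))

/-- The element which acts as an equivariant derivation on the coordinates. -/
def lift : A := ∑ i, ρ.poly (δ (X i)) * ρ.y i + ρ.liftGroup hδ

/-- Commuting `∑ δ(X_i) y_i` past `x_j` yields `δ(X_j)` and, for each reflection, a multiple of
`δ(a_s) s`. The term `(δ(a_s)/a_s) s` of `liftGroup` yields the opposite multiple, because `s` moves
`x_j` by a multiple of `a_s`. -/
theorem lift_mul_x (j : ι) :
    ρ.lift hδ * ρ.x j - ρ.x j * ρ.lift hδ = ρ.poly (δ (X j)) := by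
  have h1 : ∀ i, ρ.poly (δ (X i)) * ρ.y i * ρ.x j - ρ.x j * (ρ.poly (δ (X i)) * ρ.y i) =
      (if i = j then ρ.poly (δ (X i)) else 0) + ∑ s, (𝒟.param s * 𝒟.scale s * 𝒟.root s j) •
        (ρ.poly (C (𝒟.root s i) * δ (X i)) * ρ.w (𝒟.refl s)) := by
    intro i
    rw [← ρ.poly_X j, ← mul_assoc, ρ.poly_comm (X j), mul_assoc, mul_assoc, ← mul_sub, ρ.poly_X,
      ρ.y_x, mul_add, Finset.mul_sum]
    congr 1
    · split_ifs <;> simp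
    · refine Finset.sum_congr rfl fun s _ => ?_
      rw [map_mul, poly_C, mul_smul_comm, ← Algebra.smul_def, smul_mul_assoc, smul_smul]
      congr 1; ring
  have h2 : ∀ s, ρ.poly (hδ.rootPoly_dvd s).choose * ρ.w (𝒟.refl s) * ρ.x j -
      ρ.x j * (ρ.poly (hδ.rootPoly_dvd s).choose * ρ.w (𝒟.refl s)) =
      - (𝒟.root s j * 𝒟.scale s) • (ρ.poly (δ (𝒟.rootPoly s)) * ρ.w (𝒟.refl s)) := by
    intro s
    conv_rhs => rw [(hδ.rootPoly_dvd s).choose_spec]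
    rw [← ρ.poly_X j, mul_assoc, ρ.w_poly, 𝒟.subst_refl_X, ← mul_assoc, ← mul_assoc, ← sub_mul,
      ← map_mul, ← map_mul, ← map_sub, neg_smul, ← smul_mul_assoc, ← neg_mul]
    congr 1
    rw [← map_smul, ← map_neg, smul_eq_C_mul]
    congr 1
    simp only [C_mul]
    ring
  have h3 : ρ.liftGroup hδ * ρ.x j - ρ.x j * ρ.liftGroup hδ =
      - ∑ s, (𝒟.param s * 𝒟.scale s * 𝒟.root s j) •
        (ρ.poly (δ (𝒟.rootPoly s)) * ρ.w (𝒟.refl s)) := by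
    rw [liftGroup, Finset.sum_mul, Finset.mul_sum, ← Finset.sum_sub_distrib,
      ← Finset.sum_neg_distrib]
    refine Finset.sum_congr rfl fun s _ => ?_
    rw [smul_mul_assoc, mul_smul_comm, ← smul_sub, h2, neg_smul, smul_neg, smul_smul]
    congr 2; ring
  have h4 : ∀ s, ∑ i, ρ.poly (C (𝒟.root s i) * δ (X i)) = ρ.poly (δ (𝒟.rootPoly s)) := by
    intro s
    rw [ReflectionDatum.rootPoly, map_sum, map_sum]
    refine Finset.sum_congr rfl fun i _ => ?_
    rw [← smul_eq_C_mul, ← smul_eq_C_mul, Derivation.map_smul]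
  rw [lift, add_mul, mul_add, add_sub_add_comm, h3, Finset.sum_mul, Finset.mul_sum,
    ← Finset.sum_sub_distrib, Finset.sum_congr rfl fun i _ => h1 i, Finset.sum_add_distrib,
    Finset.sum_comm]
  simp only [← Finset.smul_sum, ← Finset.sum_mul, h4]
  simp

theorem lift_mul_poly (p : MvPolynomial ι ℂ) :
    ρ.lift hδ * ρ.poly p = ρ.poly p * ρ.lift hδ + ρ.poly (δ p) := by
  induction p using MvPolynomial.induction_on with
  | C a =>
    have : δ (C a) = 0 := by simp [← algebraMap_eq]
    rw [this, poly_C, map_zero, add_zero, Algebra.commutes]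
  | add p q hp hq =>
    simp only [map_add, mul_add, add_mul, hp, hq]
    abel
  | mul_X p j hp =>
    have h := eq_add_of_sub_eq (ρ.lift_mul_x hδ j)
    rw [Derivation.leibniz, smul_eq_mul, smul_eq_mul, mul_comm (X j), map_mul, map_add, map_mul,
      map_mul, poly_X, ← mul_assoc, hp, add_mul, mul_assoc, h, mul_add, mul_assoc]
    abel

/-! ### Modules over a realization -/

section Module

variable {M : Type*} [AddCommGroup M] [Module A M] [Module (MvPolynomial ι ℂ) M]

theorem algebraMap_smul_mem
    (hM : ∀ (p : MvPolynomial ι ℂ) (m : M), p • m = ρ.poly p • m)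
    (K : Submodule (MvPolynomial ι ℂ) M) (a : ℂ) {m : M} (hm : m ∈ K) :
    algebraMap ℂ A a • m ∈ K := by
  rw [← ρ.poly_C, ← hM]
  exact K.smul_mem _ hm

theorem aeval_smul_mem
    (hM : ∀ (p : MvPolynomial ι ℂ) (m : M), p • m = ρ.poly p • m)
    (K : Submodule (MvPolynomial ι ℂ) M) {d : A} (hd : ∀ m ∈ K, d • m ∈ K)
    (P : Polynomial ℂ) {m : M} (hm : m ∈ K) : Polynomial.aeval d P • m ∈ K := by
  induction P using Polynomial.induction_on with
  | C a => simpa using ρ.algebraMap_smul_mem hM K a hm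
  | add P Q hP hQ => rw [map_add, add_smul]; exact add_mem hP hQ
  | monomial n a h =>
    have : Polynomial.aeval d (Polynomial.C a * Polynomial.X ^ (n + 1)) =
        d * Polynomial.aeval d (Polynomial.C a * Polynomial.X ^ n) := by
      simp only [map_mul, Polynomial.aeval_C, map_pow, Polynomial.aeval_X, pow_succ']
      rw [← mul_assoc, Algebra.commutes, mul_assoc]
    rw [this, mul_smul]
    exact hd _ h

theorem lift_smul (hM : ∀ (p : MvPolynomial ι ℂ) (m : M), p • m = ρ.poly p • m)
    (p : MvPolynomial ι ℂ) (m : M) :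
    ρ.lift hδ • p • m = p • ρ.lift hδ • m + δ p • m := by
  rw [hM, hM, hM, smul_smul, lift_mul_poly, add_smul, mul_smul]

variable (hM : ∀ (p : MvPolynomial ι ℂ) (m : M), p • m = ρ.poly p • m)

/-- A submodule, regarded as a module over polynomials. -/
def toPoly (N : Submodule A M) : Submodule (MvPolynomial ι ℂ) M where
  carrier := N
  add_mem' := N.add_mem
  zero_mem' := N.zero_mem
  smul_mem' p m hm := by
    rw [hM]
    exact N.smul_mem _ hm

/-- The submodules `I N` for an ideal `I` stable under a derivation are stable under its lift. -/
theorem lift_smul_mem {I : Ideal (MvPolynomial ι ℂ)} (hI : ∀ p ∈ I, δ p ∈ I) (N : Submodule A M)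
    {m : M} (hm : m ∈ I • ρ.toPoly hM N) : ρ.lift hδ • m ∈ I • ρ.toPoly hM N := by
  refine Submodule.smul_induction_on hm (fun p hp n hn => ?_) fun a b ha hb => ?_
  · rw [ρ.lift_smul hδ hM]
    exact add_mem (Submodule.smul_mem_smul hp (N.smul_mem _ hn))
      (Submodule.smul_mem_smul (hI p hp) hn)
  · rw [smul_add]; exact add_mem ha hb

/-- The values of polynomials at the group part of a lift, modulo the ideal of an orbit, lie in a
finite-dimensional space. -/
theorem exists_aeval_liftGroup [Fintype G] (b : ι → ℂ) :
    ∃ P : Polynomial ℂ, P ≠ 0 ∧ ∃ r : G → MvPolynomial ι ℂ, (∀ g, r g ∈ 𝒟.orbitIdeal b) ∧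
      Polynomial.aeval (ρ.liftGroup hδ) P = ∑ g, ρ.poly (r g) * ρ.w g := by
  classical
  let Φ : (G → MvPolynomial ι ℂ) →ₗ[ℂ] A :=
    ∑ g, (LinearMap.mulRight ℂ (ρ.w g)) ∘ₗ ρ.poly.toLinearMap ∘ₗ LinearMap.proj g
  have hΦ : ∀ r, Φ r = ∑ g, ρ.poly (r g) * ρ.w g := fun r => by simp [Φ]
  have hsingle : ∀ g p, ρ.poly p * ρ.w g ∈ LinearMap.range Φ := by
    intro g p
    refine ⟨Pi.single g p, ?_⟩
    rw [hΦ, Finset.sum_eq_single g]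
    · simp
    · intro h _ hh
      simp [hh]
    · simp
  have hmul : ∀ a ∈ LinearMap.range Φ, ρ.liftGroup hδ * a ∈ LinearMap.range Φ := by
    rintro _ ⟨r, rfl⟩
    rw [hΦ, liftGroup, Finset.sum_mul_sum]
    refine sum_mem fun s _ => sum_mem fun g _ => ?_
    rw [smul_mul_assoc]
    refine Submodule.smul_mem _ _ ?_
    rw [mul_assoc, ← mul_assoc (ρ.w _), w_poly, mul_assoc, ← map_mul, ← mul_assoc, ← map_mul]
    exact hsingle _ _
  have hpow : ∀ k : ℕ, ∃ r, Φ r = ρ.liftGroup hδ ^ k := by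
    intro k
    induction k with
    | zero => simpa using hsingle 1 1
    | succ k ih => rw [pow_succ']; exact hmul _ ih
  choose r hr using hpow
  let Ψ : Polynomial ℂ →ₗ[ℂ] (G → MvPolynomial ι ℂ) := (Polynomial.basisMonomials ℂ).constr ℂ r
  have hΨ : ∀ P, Φ (Ψ P) = Polynomial.aeval (ρ.liftGroup hδ) P := by
    have : Φ ∘ₗ Ψ = (Polynomial.aeval (ρ.liftGroup hδ)).toLinearMap := by
      refine (Polynomial.basisMonomials ℂ).ext fun k => ?_
      have e : Ψ (Polynomial.basisMonomials ℂ k) = r k := Module.Basis.constr_basis _ _ _ _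
      rw [LinearMap.comp_apply, e, hr]
      simp [Polynomial.coe_basisMonomials, Polynomial.aeval_monomial]
    exact fun P => LinearMap.congr_fun this P
  -- Only the values of the coefficients on the orbit matter. They form a finite-dimensional space,
  -- so some nonzero polynomial in `liftGroup` has all its coefficients vanishing on the orbit.
  let ev : (G → MvPolynomial ι ℂ) →ₗ[ℂ] (G → 𝒟.orbit b → ℂ) :=
    LinearMap.pi fun g => LinearMap.pi fun q => (aeval q.1).toLinearMap ∘ₗ LinearMap.proj g
  have hni : ¬ Function.Injective (ev ∘ₗ Ψ) := fun hinj =>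
    Polynomial.not_finite (R := ℂ) (Module.Finite.of_injective (ev ∘ₗ Ψ) hinj)
  rw [← LinearMap.ker_eq_bot, Submodule.eq_bot_iff] at hni
  push Not at hni
  obtain ⟨P, hP, hP0⟩ := hni
  refine ⟨P, hP0, Ψ P, fun g => 𝒟.mem_orbitIdeal.2 fun q hq => ?_, by rw [← hΦ, hΨ]⟩
  have := congrFun (congrFun (LinearMap.mem_ker.1 hP) g) ⟨q, hq⟩
  simpa [ev, aeval_eq_eval] using this

variable {b : ι → ℂ} [Fintype G]

/-- A lift of a derivation with values in the ideal of an orbit satisfies a polynomial equation on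
`N / J N`, the same for all modules `N`. -/
theorem exists_aeval_lift_smul_mem (hδJ : ∀ p, δ p ∈ 𝒟.orbitIdeal b) :
    ∃ P : Polynomial ℂ, P ≠ 0 ∧ ∀ (N : Submodule A M), ∀ n ∈ N,
      Polynomial.aeval (ρ.lift hδ) P • n ∈ 𝒟.orbitIdeal b • ρ.toPoly hM N := by
  obtain ⟨P, hP, r, hr, hPr⟩ := ρ.exists_aeval_liftGroup hδ b
  refine ⟨P, hP, fun N n hn => ?_⟩
  set K := 𝒟.orbitIdeal b • ρ.toPoly hM N with hK
  -- The momenta enter the lift with coefficients in the orbit ideal, so modulo `K` the lift acts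
  -- through its group part. This makes `P` independent of `N`.
  have h1 : ∀ m ∈ N, (ρ.lift hδ - ρ.liftGroup hδ) • m ∈ K := by
    intro m hm
    rw [lift, add_sub_cancel_right, Finset.sum_smul]
    refine sum_mem fun i _ => ?_
    rw [mul_smul, ← hM]
    exact Submodule.smul_mem_smul (hδJ _) (N.smul_mem _ hm)
  have h2 : ∀ k : ℕ, (ρ.lift hδ ^ k - ρ.liftGroup hδ ^ k) • n ∈ K := by
    intro k
    induction k with
    | zero => simp
    | succ k ih =>
      have : ρ.lift hδ ^ (k + 1) - ρ.liftGroup hδ ^ (k + 1) =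
          ρ.lift hδ * (ρ.lift hδ ^ k - ρ.liftGroup hδ ^ k) +
            (ρ.lift hδ - ρ.liftGroup hδ) * ρ.liftGroup hδ ^ k := by
        rw [pow_succ', pow_succ']; noncomm_ring
      rw [this, add_smul, mul_smul, mul_smul]
      exact add_mem (ρ.lift_smul_mem hδ hM (fun p _ => hδJ p) N ih) (h1 _ (N.smul_mem _ hn))
  have h3 : (Polynomial.aeval (ρ.lift hδ) P - Polynomial.aeval (ρ.liftGroup hδ) P) • n ∈ K := by
    rw [Polynomial.aeval_eq_sum_range, Polynomial.aeval_eq_sum_range, ← Finset.sum_sub_distrib,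
      Finset.sum_smul]
    refine sum_mem fun k _ => ?_
    rw [← smul_sub, Algebra.smul_def, mul_smul]
    exact ρ.algebraMap_smul_mem hM K _ (h2 k)
  have h4 : Polynomial.aeval (ρ.liftGroup hδ) P • n ∈ K := by
    rw [hPr, Finset.sum_smul]
    refine sum_mem fun g _ => ?_
    rw [mul_smul, ← hM]
    exact Submodule.smul_mem_smul (hr g) (N.smul_mem _ hn)
  rw [sub_smul] at h3
  simpa using add_mem h3 h4

/-- Comparison of the action of a lift on `J ^ k N / J ^ (k + 1) N` with that on `N / J N`. -/
theorem aeval_lift_smul_mem (hδJ : ∀ p, δ p ∈ 𝒟.orbitIdeal b)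
    (hδ1 : ∀ p ∈ 𝒟.orbitIdeal b, δ p - p ∈ 𝒟.orbitIdeal b ^ 2) {P : Polynomial ℂ}
    {N : Submodule A M}
    (hP : ∀ n ∈ N, Polynomial.aeval (ρ.lift hδ) P • n ∈ 𝒟.orbitIdeal b • ρ.toPoly hM N)
    (k : ℕ) {m : M} (hm : m ∈ 𝒟.orbitIdeal b ^ k • ρ.toPoly hM N) :
    Polynomial.aeval (ρ.lift hδ) (P.comp (Polynomial.X - Polynomial.C (k : ℂ))) • m ∈
      𝒟.orbitIdeal b ^ (k + 1) • ρ.toPoly hM N := by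
  set J := 𝒟.orbitIdeal b with hJ
  have hk : ∀ k : ℕ, ∀ p ∈ J ^ k, δ p - (k : MvPolynomial ι ℂ) * p ∈ J ^ (k + 1) := by
    intro k
    have := derivation_pow_sub_mem (δ := δ) (J := J) (𝔭 := ⊥) (by simpa using hδJ)
      (by simpa using hδ1) k
    simpa using this
  have hst : ∀ k : ℕ, ∀ p ∈ J ^ k, δ p ∈ J ^ k := by
    intro k p hp
    have := add_mem (Ideal.pow_le_pow_right k.le_succ (hk k p hp))
      (Ideal.mul_mem_left _ (k : MvPolynomial ι ℂ) hp)
    simpa using this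
  -- On `J ^ k` the derivation is multiplication by `k` modulo `J ^ (k + 1)`; hence `d` passes
  -- through a coefficient in `J ^ k` and becomes the lift itself acting on `N`.
  set d : A := ρ.lift hδ - algebraMap ℂ A k with hd
  have hdm : ∀ (p : MvPolynomial ι ℂ) (n : M), d • p • n =
      p • ρ.lift hδ • n + (δ p - (k : MvPolynomial ι ℂ) * p) • n := by
    intro p n
    rw [hd, sub_smul, ρ.lift_smul hδ hM, ← ρ.poly_C, ← hM, map_natCast, sub_smul, mul_smul]
    abel
  have hdst : ∀ z ∈ J ^ (k + 1) • ρ.toPoly hM N, d • z ∈ J ^ (k + 1) • ρ.toPoly hM N := by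
    intro z hz
    rw [hd, sub_smul]
    exact sub_mem (ρ.lift_smul_mem hδ hM (hst _) N hz) (ρ.algebraMap_smul_mem hM _ _ hz)
  have hpow : ∀ p ∈ J ^ k, ∀ n ∈ N, ∀ l : ℕ,
      d ^ l • p • n - p • ρ.lift hδ ^ l • n ∈ J ^ (k + 1) • ρ.toPoly hM N := by
    intro p hp n hn l
    induction l with
    | zero => simp
    | succ l ih =>
      have : d ^ (l + 1) • p • n - p • ρ.lift hδ ^ (l + 1) • n =
          d • (d ^ l • p • n - p • ρ.lift hδ ^ l • n) +
            (δ p - (k : MvPolynomial ι ℂ) * p) • ρ.lift hδ ^ l • n := by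
        rw [smul_sub, hdm, pow_succ', pow_succ', mul_smul, mul_smul]
        abel
      rw [this]
      exact add_mem (hdst _ ih) (Submodule.smul_mem_smul (hk k p hp) (N.smul_mem _ hn))
  have haeval : ∀ p ∈ J ^ k, ∀ n ∈ N, Polynomial.aeval d P • p • n -
      p • Polynomial.aeval (ρ.lift hδ) P • n ∈ J ^ (k + 1) • ρ.toPoly hM N := by
    intro p hp n hn
    rw [Polynomial.aeval_eq_sum_range, Polynomial.aeval_eq_sum_range, Finset.sum_smul,
      Finset.sum_smul, Finset.smul_sum, ← Finset.sum_sub_distrib]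
    refine sum_mem fun l _ => ?_
    have : (P.coeff l • d ^ l) • p • n - p • (P.coeff l • ρ.lift hδ ^ l) • n =
        algebraMap ℂ A (P.coeff l) • (d ^ l • p • n - p • ρ.lift hδ ^ l • n) := by
      have e : ∀ z : M, p • algebraMap ℂ A (P.coeff l) • z = algebraMap ℂ A (P.coeff l) • p • z := by
        intro z
        rw [hM, hM, smul_smul, smul_smul, Algebra.commutes]
      rw [smul_sub, Algebra.smul_def, Algebra.smul_def, mul_smul, mul_smul, e]
    rw [this]
    exact ρ.algebraMap_smul_mem hM _ _ (hpow p hp n hn l)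
  have hcomp : Polynomial.aeval (ρ.lift hδ) (P.comp (Polynomial.X - Polynomial.C (k : ℂ))) =
      Polynomial.aeval d P := by
    rw [Polynomial.aeval_comp]
    simp [hd]
  rw [hcomp]
  refine Submodule.smul_induction_on hm (fun p hp n hn => ?_) fun a b ha hb => ?_
  · have h1 : p • Polynomial.aeval (ρ.lift hδ) P • n ∈ J ^ (k + 1) • ρ.toPoly hM N := by
      rw [pow_succ, ← smul_eq_mul, Submodule.smul_assoc]
      exact Submodule.smul_mem_smul hp (hP n hn)
    simpa using add_mem (haeval p hp n hn) h1
  · rw [smul_add]; exact add_mem ha hb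

end Module

end Realization

end RationalCherednik

/-! ### Uniform Artin–Rees, support and finite length. -/

namespace RationalCherednik

open MvPolynomial

/-- A nonzero polynomial is coprime to its translates by all large integers. -/
theorem exists_forall_isCoprime_comp {P : Polynomial ℂ} (hP : P ≠ 0) :
    ∃ k : ℕ, ∀ j ≥ k, IsCoprime P (P.comp (Polynomial.X - Polynomial.C (j : ℂ))) := by
  classical
  -- A common root of `P` and its translate by `j` gives two roots of `P` at distance `j`, so any
  -- `k` above all distances between roots works.
  obtain ⟨k, hk⟩ : ∃ k : ℕ, ∀ z ∈ P.roots.toFinset, ∀ z' ∈ P.roots.toFinset, ‖z - z'‖ < k := by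
    obtain ⟨k, hk⟩ := exists_nat_gt
      (∑ z ∈ P.roots.toFinset, ∑ z' ∈ P.roots.toFinset, ‖z - z'‖)
    refine ⟨k, fun z hz z' hz' => lt_of_le_of_lt ?_ hk⟩
    exact (Finset.single_le_sum (f := fun z' => ‖z - z'‖) (fun _ _ => norm_nonneg _) hz').trans
      (Finset.single_le_sum (f := fun z => ∑ z' ∈ P.roots.toFinset, ‖z - z'‖)
        (fun _ _ => Finset.sum_nonneg fun _ _ => norm_nonneg _) hz)
  refine ⟨k, fun j hj => ?_⟩
  rw [Polynomial.isCoprime_iff_aeval_ne_zero_of_isAlgClosed (k := ℂ) ℂ]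
  intro z
  by_contra! h
  obtain ⟨h1, h2⟩ := h
  have hz : z ∈ P.roots.toFinset := by simpa [hP] using h1
  have hz' : z - j ∈ P.roots.toFinset := by
    simpa [hP, Polynomial.aeval_comp] using h2
  have := hk z hz _ hz'
  simp only [sub_sub_cancel, Complex.norm_natCast, Nat.cast_lt] at this
  omega

/-- A prime containing a power of the orbit ideal contains, hence equals, the maximal ideal of some
orbit point. The quotient ring is Noetherian of dimension 0, thus Artinian. -/
theorem ReflectionDatum.isArtinian_quotient_orbitIdeal_pow {ι G S : Type*} [Fintype ι]
    [DecidableEq ι] [Group G] [Fintype G] (𝒟 : ReflectionDatum ι G S) {M : Type*} [AddCommGroup M]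
    [Module (MvPolynomial ι ℂ) M] [Module.Finite (MvPolynomial ι ℂ) M]
    (b : ι → ℂ) (k : ℕ) :
    IsArtinian (MvPolynomial ι ℂ) (M ⧸ 𝒟.orbitIdeal b ^ k • (⊤ : Submodule (MvPolynomial ι ℂ) M)) := by
  have hdim : Ring.KrullDimLE 0 (MvPolynomial ι ℂ ⧸ 𝒟.orbitIdeal b ^ k) := by
    rw [Ring.krullDimLE_zero_iff]
    intro P hP
    set φ := Ideal.Quotient.mk (𝒟.orbitIdeal b ^ k) with hφ
    have hP' : (P.comap φ).IsPrime := Ideal.comap_isPrime _ _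
    have hle : 𝒟.orbitIdeal b ≤ P.comap φ := by
      refine hP'.le_of_pow_le (n := k) fun p hp => ?_
      rw [Ideal.mem_comap, hφ, Ideal.Quotient.eq_zero_iff_mem.2 hp]
      exact P.zero_mem
    obtain ⟨q, _, hq⟩ := (hP'.prod_le).1 hle
    have hmax : (P.comap φ).IsMaximal := by
      rw [← (inferInstance : (pointIdeal q).IsMaximal).eq_of_le hP'.ne_top hq]
      infer_instance
    rw [← Ideal.map_comap_of_surjective φ Ideal.Quotient.mk_surjective P]
    refine (Ideal.map_eq_top_or_isMaximal_of_surjective φ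
      Ideal.Quotient.mk_surjective hmax).resolve_left ?_
    rw [Ideal.map_comap_of_surjective φ Ideal.Quotient.mk_surjective P]
    exact hP.ne_top
  have hart : IsArtinianRing (MvPolynomial ι ℂ ⧸ 𝒟.orbitIdeal b ^ k) :=
    IsNoetherianRing.isArtinianRing_of_krullDimLE_zero
  have hfin : Module.Finite (MvPolynomial ι ℂ ⧸ 𝒟.orbitIdeal b ^ k)
      (M ⧸ 𝒟.orbitIdeal b ^ k • (⊤ : Submodule (MvPolynomial ι ℂ) M)) :=
    Module.Finite.of_restrictScalars_finite (MvPolynomial ι ℂ) _ _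
  exact isArtinian_of_surjective_algebraMap (R := MvPolynomial ι ℂ ⧸ 𝒟.orbitIdeal b ^ k)
    Ideal.Quotient.mk_surjective

namespace Realization

variable {ι G S : Type*} [Fintype ι] [DecidableEq ι] [Group G] [Fintype S]
  {𝒟 : ReflectionDatum ι G S} {A : Type*} [Ring A] [Algebra ℂ A] (ρ : Realization 𝒟 A)
  {M : Type*} [AddCommGroup M] [Module A M] [Module (MvPolynomial ι ℂ) M]
  (hM : ∀ (p : MvPolynomial ι ℂ) (m : M), p • m = ρ.poly p • m)

/-- A uniform version of the Artin–Rees lemma. -/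
theorem exists_pow_inf_le [Fintype G] [Module.Finite (MvPolynomial ι ℂ) M] (b : ι → ℂ) :
    ∃ k : ℕ, ∀ N : Submodule A M, 𝒟.orbitIdeal b ^ k • ⊤ ⊓ ρ.toPoly hM N ≤
      𝒟.orbitIdeal b • ρ.toPoly hM N := by
  obtain ⟨δ, hδ, hδJ, hδ1⟩ := 𝒟.exists_equivariant_euler b
  obtain ⟨P, hP0, hP⟩ := ρ.exists_aeval_lift_smul_mem hδ hM hδJ
  obtain ⟨k, hk⟩ := exists_forall_isCoprime_comp hP0
  set J := 𝒟.orbitIdeal b with hJ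
  refine ⟨k, fun N => ?_⟩
  -- The classical constant `l` depends on `N`; it affects only the number of factors of `Q`, not
  -- `k`.
  obtain ⟨l, hl⟩ := Ideal.exists_pow_inf_eq_pow_smul J (ρ.toPoly hM N)
  have hAR : J ^ (k + l + 1) • ⊤ ⊓ ρ.toPoly hM N ≤ J • ρ.toPoly hM N := by
    refine le_trans (inf_le_inf_right _ (Submodule.smul_mono_left
      (Ideal.pow_le_pow_right (by omega : l + 1 ≤ k + l + 1)))) ?_
    rw [hl (l + 1) (by omega), Nat.add_sub_cancel_left, pow_one]
    exact smul_mono_right _ inf_le_right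
  have htop : ρ.toPoly hM ⊤ = ⊤ := rfl
  -- `Q` is the product of the translates of `P` by `k, ..., k + m - 1`, all coprime to `P`. Applied
  -- to `J ^ k M ∩ N`, `P` lands in `J N`, and `Q` does so by Artin–Rees; a Bézout relation then
  -- puts the element itself in `J N`.
  have hQ : ∀ m : ℕ, ∃ Q : Polynomial ℂ, IsCoprime P Q ∧
      ∀ z ∈ J ^ k • (⊤ : Submodule (MvPolynomial ι ℂ) M),
      Polynomial.aeval (ρ.lift hδ) Q • z ∈ J ^ (k + m) • (⊤ : Submodule (MvPolynomial ι ℂ) M) := by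
    intro m
    induction m with
    | zero => exact ⟨1, isCoprime_one_right, fun z hz => by simpa using hz⟩
    | succ m ih =>
      obtain ⟨Q, hPQ, hQ⟩ := ih
      refine ⟨P.comp (Polynomial.X - Polynomial.C ((k + m : ℕ) : ℂ)) * Q,
        (hk _ (by omega)).mul_right hPQ, fun z hz => ?_⟩
      rw [map_mul, mul_smul, ← add_assoc, ← htop]
      refine ρ.aeval_lift_smul_mem hδ hM hδJ hδ1 (hP ⊤) (k + m) ?_
      rw [htop]
      exact hQ z hz
  obtain ⟨Q, ⟨u, v, huv⟩, hQ⟩ := hQ (l + 1)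
  rintro z ⟨hz, hzN⟩
  have hst : ∀ m ∈ J • ρ.toPoly hM N, ρ.lift hδ • m ∈ J • ρ.toPoly hM N := fun m hm =>
    ρ.lift_smul_mem hδ hM (fun p _ => hδJ p) N hm
  have h1 : Polynomial.aeval (ρ.lift hδ) P • z ∈ J • ρ.toPoly hM N := hP N z hzN
  have h2 : Polynomial.aeval (ρ.lift hδ) Q • z ∈ J • ρ.toPoly hM N :=
    hAR ⟨hQ z hz, N.smul_mem _ hzN⟩
  have h3 := add_mem (ρ.aeval_smul_mem hM _ hst u h1) (ρ.aeval_smul_mem hM _ hst v h2)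
  rwa [smul_smul, smul_smul, ← add_smul, ← map_mul, ← map_mul, ← map_add, huv, map_one,
    one_smul] at h3

/-- If `N` and `N'` are distinct, the support of `N / N'` contains every point whose stabilizer is
that of some point of the support. -/
theorem exists_stab_not_le [Fintype G] [Module.Finite (MvPolynomial ι ℂ) M] {N' N : Submodule A M}
    (h : N' < N) : ∃ b₀, ∀ b, 𝒟.stab b₀ ⊆ 𝒟.stab b →
      ¬ ρ.toPoly hM N ≤ ρ.toPoly hM N' ⊔ 𝒟.orbitIdeal b • ρ.toPoly hM N := by
  -- The annihilator of `(N + N') / N'`. It is stable under `δ` since `δ p` acts as the commutator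
  -- of the lift with `p`.
  let I : Ideal (MvPolynomial ι ℂ) :=
    { carrier := {p | ∀ n ∈ N, p • n ∈ ρ.toPoly hM N'}
      add_mem' := fun {p q} hp hq n hn => by
        rw [add_smul]; exact add_mem (hp n hn) (hq n hn)
      zero_mem' := fun n _ => by simp
      smul_mem' := fun r p hp n hn => by
        rw [smul_eq_mul, mul_smul]; exact Submodule.smul_mem _ _ (hp n hn) }
  have hI : I ≠ ⊤ := by
    intro hI
    refine h.not_ge fun n hn => ?_
    have : (1 : MvPolynomial ι ℂ) ∈ I := by rw [hI]; trivial
    have := this n hn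
    rwa [one_smul] at this
  have hIst : ∀ δ, 𝒟.IsEquivariant δ → ∀ p ∈ I, δ p ∈ I := by
    intro δ hδ p hp n hn
    have h1 := ρ.lift_smul hδ hM p n
    have h2 : δ p • n = ρ.lift hδ • p • n - p • ρ.lift hδ • n := by rw [h1]; abel
    rw [h2]
    exact sub_mem (N'.smul_mem _ (hp n hn)) (hp _ (N.smul_mem _ hn))
  obtain ⟨b₀, hb₀⟩ := exists_le_pointIdeal hI
  refine ⟨b₀, fun b hb hle => ?_⟩
  have hIb := 𝒟.le_pointIdeal_of_stable hIst hb₀ hb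
  -- Nakayama: if `K = J K`, some `r ≡ 1` modulo `J` annihilates `K`, so `r` lies in `I` and
  -- vanishes at `b`, although its value there is 1.
  set K := (ρ.toPoly hM N).map (ρ.toPoly hM N').mkQ with hK
  have hKle : K ≤ 𝒟.orbitIdeal b • K := by
    have := Submodule.map_mono (f := (ρ.toPoly hM N').mkQ) hle
    rw [Submodule.map_sup, Submodule.map_smul''] at this
    refine this.trans (sup_le ?_ le_rfl)
    rw [Submodule.mkQ_map_self]
    exact bot_le
  have hKfg : K.FG := (IsNoetherian.noetherian (ρ.toPoly hM N)).map _
  obtain ⟨r, hr, hrK⟩ := Submodule.exists_sub_one_mem_and_smul_eq_zero_of_fg_of_le_smul _ K hKfg hKle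
  have hrI : r ∈ I := by
    intro n hn
    have := hrK _ (Submodule.mem_map_of_mem (f := (ρ.toPoly hM N').mkQ) hn)
    rwa [← map_smul, Submodule.mkQ_apply, Submodule.Quotient.mk_eq_zero] at this
  have h1 := hIb hrI
  have h2 := 𝒟.orbitIdeal_le b hr
  refine (Ideal.ne_top_iff_one (pointIdeal b)).1 (Ideal.IsMaximal.ne_top inferInstance) ?_
  simpa using sub_mem h1 h2

/-- A module over a realization which is finitely generated over polynomials in the coordinates has
finite length. -/
theorem isFiniteLength [Finite G] [Module.Finite (MvPolynomial ι ℂ) M]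
    (hM : ∀ (p : MvPolynomial ι ℂ) (m : M), p • m = ρ.poly p • m) : IsFiniteLength A M := by
  have := Fintype.ofFinite G
  rw [isFiniteLength_iff_isNoetherian_isArtinian]
  have hlt : StrictMono (ρ.toPoly hM) := fun N' N h => h
  refine ⟨isNoetherian_iff'.2 hlt.wellFoundedGT, ?_⟩
  · choose k hk using ρ.exists_pow_inf_le hM
    -- There are finitely many stabilizers, so one representative point for each gives a finite
    -- product of Artinian modules as target of `f`.
    let T := {t : Finset G // ∃ b, 𝒟.stab b = t}
    let pt : T → (ι → ℂ) := fun t => t.2.choose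
    have hpt : ∀ t : T, 𝒟.stab (pt t) = t.1 := fun t => t.2.choose_spec
    have hart := fun t : T =>
      𝒟.isArtinian_quotient_orbitIdeal_pow (M := M) (pt t) (k (pt t))
    let f : Submodule A M → ∀ t : T, Submodule (MvPolynomial ι ℂ)
        (M ⧸ 𝒟.orbitIdeal (pt t) ^ k (pt t) • (⊤ : Submodule (MvPolynomial ι ℂ) M)) :=
      fun N t => (ρ.toPoly hM N).map (Submodule.mkQ _)
    have hf : StrictMono f := by
      intro N' N h
      refine lt_of_le_not_ge (fun t => Submodule.map_mono (hlt h).le) fun hle => ?_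
      obtain ⟨b₀, hb₀⟩ := ρ.exists_stab_not_le hM h
      let t : T := ⟨𝒟.stab b₀, b₀, rfl⟩
      refine hb₀ (pt t) (by rw [hpt t]) fun n hn => ?_
      obtain ⟨n', hn', hnn'⟩ := hle t (Submodule.mem_map_of_mem hn)
      rw [Submodule.mkQ_apply, Submodule.mkQ_apply, Submodule.Quotient.eq] at hnn'
      have h1 : n - n' ∈ 𝒟.orbitIdeal (pt t) • ρ.toPoly hM N := by
        refine hk (pt t) N ⟨?_, sub_mem hn (h.le hn')⟩
        simpa using neg_mem hnn'
      have := Submodule.add_mem_sup hn' h1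
      simpa using this
    exact hf.wellFoundedLT

end Realization

end RationalCherednik

namespace RationalCherednik

open MvPolynomial

/-! ### Invariant polynomials -/

namespace ReflectionDatum

variable {ι G S : Type*} [Fintype ι] [DecidableEq ι] [Group G] (𝒟 : ReflectionDatum ι G S)

/-- The invariant polynomials. -/
def invariants : Subalgebra ℂ (MvPolynomial ι ℂ) where
  carrier := {p | ∀ g, 𝒟.subst g p = p}
  mul_mem' hp hq g := by rw [map_mul, hp g, hq g]
  add_mem' hp hq g := by rw [map_add, hp g, hq g]
  algebraMap_mem' a g := by rw [AlgHom.commutes]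

/-- Polynomials are integral over the invariants of a finite group and of finite type. Artin–Tate
then gives `fg_invariants`. -/
theorem finite_invariants [Finite G] : Module.Finite 𝒟.invariants (MvPolynomial ι ℂ) := by
  let _ : MulSemiringAction G (MvPolynomial ι ℂ) :=
    { smul := fun g p => 𝒟.subst g p
      one_smul := fun p => by
        change 𝒟.subst 1 p = p
        simp
      mul_smul := fun g h p => 𝒟.subst_mul_apply g h p
      smul_zero := fun g => map_zero (𝒟.subst g)
      smul_add := fun g => map_add (𝒟.subst g)
      smul_one := fun g => map_one (𝒟.subst g)
      smul_mul := fun g => map_mul (𝒟.subst g) }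
  have : Algebra.IsInvariant 𝒟.invariants (MvPolynomial ι ℂ) G := ⟨fun p hp => ⟨⟨p, hp⟩, rfl⟩⟩
  have := Algebra.IsInvariant.isIntegral 𝒟.invariants (MvPolynomial ι ℂ) G
  have : Algebra.FiniteType 𝒟.invariants (MvPolynomial ι ℂ) :=
    Algebra.FiniteType.of_restrictScalars_finiteType ℂ _ _
  exact Algebra.IsIntegral.finite

theorem fg_invariants [Finite G] : 𝒟.invariants.FG := by
  have := 𝒟.finite_invariants
  rw [← Subalgebra.fg_top]
  exact fg_of_fg_of_fg ℂ 𝒟.invariants (MvPolynomial ι ℂ) (Algebra.FiniteType.out)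
    Module.Finite.fg_top Subtype.val_injective

theorem exists_fg_mul_invariants [Finite G] : ∃ F : Submodule ℂ (MvPolynomial ι ℂ), F.FG ∧
    F * Subalgebra.toSubmodule 𝒟.invariants = ⊤ := by
  obtain ⟨s, hs⟩ := 𝒟.finite_invariants.fg_top
  refine ⟨Submodule.span ℂ s, ⟨s, rfl⟩, top_unique fun p _ => ?_⟩
  have hp : p ∈ Submodule.span 𝒟.invariants (s : Set (MvPolynomial ι ℂ)) := by rw [hs]; trivial
  refine Submodule.span_induction ?_ ?_ ?_ ?_ hp
  · intro x hx
    rw [← mul_one x]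
    exact Submodule.mul_mem_mul (Submodule.subset_span hx) (one_mem 𝒟.invariants)
  · exact zero_mem _
  · exact fun x y _ _ hx hy => add_mem hx hy
  · intro r x _ hx
    refine Submodule.mul_induction_on hx (fun a ha b hb => ?_) fun a b ha hb => ?_
    · have : r • (a * b) = a * (b * r.1) := by
        change r.1 * (a * b) = _; ring
      rw [this]
      exact Submodule.mul_mem_mul ha (mul_mem (S := Subalgebra ℂ (MvPolynomial ι ℂ)) hb r.2)
    · rw [smul_add]; exact add_mem ha hb

end ReflectionDatum

/-! ### Triangular decomposition -/

section Triangular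

variable {A : Type*} [Ring A] [Algebra ℂ A]

theorem exists_mul_eq_mul_of_mem_adjoin {s : Set A} {w : A}
    (h : ∀ x ∈ s, ∃ a ∈ Algebra.adjoin ℂ s, w * x = a * w) {x : A} (hx : x ∈ Algebra.adjoin ℂ s) :
    ∃ a ∈ Algebra.adjoin ℂ s, w * x = a * w := by
  induction hx using Algebra.adjoin_induction with
  | mem x hx => exact h x hx
  | algebraMap r => exact ⟨_, algebraMap_mem _ r, (Algebra.commutes r w).symm⟩
  | add x y _ _ hx hy =>
    obtain ⟨a, ha, hx⟩ := hx
    obtain ⟨b, hb, hy⟩ := hy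
    exact ⟨a + b, add_mem ha hb, by rw [mul_add, add_mul, hx, hy]⟩
  | mul x y _ _ hx hy =>
    obtain ⟨a, ha, hx⟩ := hx
    obtain ⟨b, hb, hy⟩ := hy
    exact ⟨a * b, mul_mem ha hb, by rw [← mul_assoc, hx, mul_assoc, hy, mul_assoc]⟩

/-- The spanning half of the PBW decomposition: the product of the three subspaces contains 1 and is
stable under left multiplication by every generator. The hypotheses are symmetric in `x` and `y`, so
it serves for both orders. -/
theorem adjoin_mul_span_mul_adjoin_eq_top {ι κ G : Type*} [Group G] {x : ι → A} {y : κ → A}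
    {w : G →* A}
    (hx : ∀ g j, ∃ a ∈ Algebra.adjoin ℂ (Set.range x), w g * x j = a * w g)
    (hy : ∀ g j, ∃ a ∈ Algebra.adjoin ℂ (Set.range y), w g * y j = a * w g)
    (hyx : ∀ i j, y i * x j - x j * y i ∈ Submodule.span ℂ (Set.range w))
    (hgen : Algebra.adjoin ℂ (Set.range x ∪ Set.range y ∪ Set.range w) = ⊤) :
    Subalgebra.toSubmodule (Algebra.adjoin ℂ (Set.range x)) * Submodule.span ℂ (Set.range w) *
      Subalgebra.toSubmodule (Algebra.adjoin ℂ (Set.range y)) = ⊤ := by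
  set CX := Subalgebra.toSubmodule (Algebra.adjoin ℂ (Set.range x)) with hCX
  set CY := Subalgebra.toSubmodule (Algebra.adjoin ℂ (Set.range y)) with hCY
  set CW := Submodule.span ℂ (Set.range w) with hCW
  set CY1 := Submodule.span ℂ (Set.range y) with hCY1
  have hXX : CX * CX = CX := (Subalgebra.isIdempotentElem_toSubmodule _).eq
  have hYY : CY * CY = CY := (Subalgebra.isIdempotentElem_toSubmodule _).eq
  have hWW : CW * CW ≤ CW := by
    rw [hCW, Submodule.span_mul_span, Submodule.span_le]
    rintro _ ⟨_, ⟨g, rfl⟩, _, ⟨h, rfl⟩, rfl⟩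
    exact Submodule.subset_span ⟨g * h, map_mul w g h⟩
  have h1X : (1 : A) ∈ CX := one_mem (Algebra.adjoin ℂ (Set.range x))
  have h1Y : (1 : A) ∈ CY := one_mem (Algebra.adjoin ℂ (Set.range y))
  have h1W : (1 : A) ∈ CW := Submodule.subset_span ⟨1, map_one w⟩
  have hY1 : CY1 ≤ CY := Algebra.span_le_adjoin ℂ _
  have hWX : CW * CX ≤ CX * CW := by
    rw [Submodule.mul_le]
    intro c hc a ha
    refine Submodule.span_induction ?_ ?_ ?_ ?_ hc
    · rintro _ ⟨g, rfl⟩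
      obtain ⟨a', ha', h⟩ := exists_mul_eq_mul_of_mem_adjoin (w := w g)
        (by rintro _ ⟨j, rfl⟩; exact hx g j) ha
      rw [h]
      exact Submodule.mul_mem_mul ha' (Submodule.subset_span ⟨g, rfl⟩)
    · simp
    · intro c c' _ _ h h'
      rw [add_mul]; exact add_mem h h'
    · intro r c _ h
      rw [smul_mul_assoc]; exact Submodule.smul_mem _ _ h
  have hYW : CY1 * CW ≤ CW * CY := by
    rw [hCY1, hCW, Submodule.span_mul_span, Submodule.span_le]
    rintro _ ⟨_, ⟨j, rfl⟩, _, ⟨g, rfl⟩, rfl⟩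
    obtain ⟨a, ha, h⟩ := hy g⁻¹ j
    have : y j * w g = w g * a := by
      have e1 : w g * w g⁻¹ = 1 := by rw [← map_mul]; simp
      have e2 : w g⁻¹ * w g = 1 := by rw [← map_mul]; simp
      calc y j * w g = w g * (w g⁻¹ * y j) * w g := by rw [← mul_assoc, e1, one_mul]
        _ = w g * a := by rw [h, mul_assoc, mul_assoc, e2, mul_one]
    change y j * w g ∈ _
    rw [this]
    exact Submodule.mul_mem_mul (Submodule.subset_span ⟨g, rfl⟩) ha
  -- Moving a single `y` to the right past a polynomial in `x` leaves either that `y` or a group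
  -- element.
  set K := CX * CY1 ⊔ CX * CW with hK
  have hXK : CX * K ≤ K := by
    rw [hK, Submodule.mul_sup, ← mul_assoc, ← mul_assoc, hXX]
  have hYX : ∀ a ∈ CX, ∀ z ∈ CY1, z * a ∈ K := by
    intro a ha
    have ha' : a ∈ Algebra.adjoin ℂ (Set.range x) := ha
    clear ha
    induction ha' using Algebra.adjoin_induction with
    | mem a ha =>
      obtain ⟨j, rfl⟩ := ha
      intro z hz
      refine Submodule.span_induction ?_ ?_ ?_ ?_ hz
      · rintro _ ⟨i, rfl⟩
        rw [← sub_add_cancel (y i * x j) (x j * y i), add_comm]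
        refine Submodule.add_mem_sup (Submodule.mul_mem_mul
          (Algebra.subset_adjoin ⟨j, rfl⟩) (Submodule.subset_span ⟨i, rfl⟩)) ?_
        rw [← one_mul (_ - _)]
        exact Submodule.mul_mem_mul h1X (hyx i j)
      · simp
      · intro c c' _ _ h h'
        rw [add_mul]; exact add_mem h h'
      · intro r c _ h
        rw [smul_mul_assoc]; exact Submodule.smul_mem _ _ h
    | algebraMap r =>
      intro z hz
      rw [← Algebra.commutes]
      exact Submodule.mem_sup_left (Submodule.mul_mem_mul
        (algebraMap_mem (Algebra.adjoin ℂ (Set.range x)) r) hz)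
    | add a b _ _ ha hb =>
      intro z hz
      rw [mul_add]; exact add_mem (ha z hz) (hb z hz)
    | mul a b _ hb' ha hb =>
      intro z hz
      rw [← mul_assoc]
      obtain ⟨u, hu, v, hv, huv⟩ := Submodule.mem_sup.1 (ha z hz)
      rw [← huv, add_mul]
      refine add_mem ?_ ?_
      · refine Submodule.mul_induction_on hu (fun p hp q hq => ?_) fun p q hp hq => ?_
        · rw [mul_assoc]
          exact hXK (Submodule.mul_mem_mul hp (hb q hq))
        · rw [add_mul]; exact add_mem hp hq
      · refine Submodule.mem_sup_right ?_
        have : v * b ∈ CX * CW * CX := Submodule.mul_mem_mul hv hb'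
        rw [mul_assoc] at this
        have h2 := (mul_le_mul_right hWX CX : CX * (CW * CX) ≤ _) this
        rwa [← mul_assoc, hXX] at h2
  set T := CX * CW * CY with hT
  have h1T : (1 : A) ∈ T := by
    have := Submodule.mul_mem_mul (Submodule.mul_mem_mul h1X h1W) h1Y
    simpa using this
  have hXT : CX * T ≤ T := by rw [hT, ← mul_assoc, ← mul_assoc, hXX]
  have hWT : CW * T ≤ T := by
    calc CW * T = (CW * CX) * (CW * CY) := by rw [hT]; simp only [mul_assoc]
      _ ≤ (CX * CW) * (CW * CY) := mul_le_mul_left hWX _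
      _ = CX * (CW * CW) * CY := by simp only [mul_assoc]
      _ ≤ T := mul_le_mul_left (mul_le_mul_right hWW _) _
  have hYT : CY1 * T ≤ T := by
    have hYX' : CY1 * CX ≤ K := Submodule.mul_le.2 fun z hz a ha => hYX a ha z hz
    calc CY1 * T = (CY1 * CX) * (CW * CY) := by rw [hT]; simp only [mul_assoc]
      _ ≤ K * (CW * CY) := mul_le_mul_left hYX' _
      _ = CX * (CY1 * CW) * CY ⊔ CX * (CW * CW) * CY := by
        rw [hK, Submodule.sup_mul]; simp only [mul_assoc]
      _ ≤ CX * (CW * CY) * CY ⊔ T := sup_le_sup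
        (mul_le_mul_left (mul_le_mul_right hYW _) _) (mul_le_mul_left (mul_le_mul_right hWW _) _)
      _ = CX * CW * (CY * CY) ⊔ T := by simp only [mul_assoc]
      _ = T := by rw [hYY, ← hT, sup_idem]
  have key : ∀ a ∈ Algebra.adjoin ℂ (Set.range x ∪ Set.range y ∪ Set.range w), ∀ t ∈ T,
      a * t ∈ T := by
    intro a ha
    induction ha using Algebra.adjoin_induction with
    | mem a ha =>
      intro t ht
      rcases ha with (⟨j, rfl⟩ | ⟨j, rfl⟩) | ⟨g, rfl⟩
      · exact hXT (Submodule.mul_mem_mul (Algebra.subset_adjoin ⟨j, rfl⟩) ht)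
      · exact hYT (Submodule.mul_mem_mul (Submodule.subset_span ⟨j, rfl⟩) ht)
      · exact hWT (Submodule.mul_mem_mul (Submodule.subset_span ⟨g, rfl⟩) ht)
    | algebraMap r =>
      intro t ht
      rw [← Algebra.smul_def]; exact T.smul_mem r ht
    | add a b _ _ ha hb =>
      intro t ht
      rw [add_mul]; exact add_mem (ha t ht) (hb t ht)
    | mul a b _ _ ha hb =>
      intro t ht
      rw [mul_assoc]; exact ha _ (hb t ht)
  refine top_unique fun a _ => ?_
  have := key a (by rw [hgen]; trivial) 1 h1T
  rwa [mul_one] at this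

end Triangular

end RationalCherednik

namespace RationalCherednik

open MvPolynomial

/-! ### Finitely generated subspaces -/

section Subspaces

variable {A M : Type*} [Ring A] [Algebra ℂ A] [AddCommGroup M] [Module ℂ M] [Module A M]
  [IsScalarTower ℂ A M]

theorem fg_smul {I : Submodule ℂ A} {N : Submodule ℂ M} (hI : I.FG) (hN : N.FG) : (I • N).FG := by
  have : I • N = Submodule.map₂ (Algebra.lsmul ℂ ℂ M).toLinearMap I N :=
    le_antisymm (Submodule.smul_le.2 fun a ha n hn =>
      Submodule.apply_mem_map₂ (Algebra.lsmul ℂ ℂ M).toLinearMap ha hn)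
      (Submodule.map₂_le.2 fun a ha n hn => Submodule.smul_mem_smul ha hn)
  rw [this]
  exact hI.map₂ _ hN

theorem mul_smul_subspace (I J : Submodule ℂ A) (N : Submodule ℂ M) : (I * J) • N = I • J • N :=
  Submodule.smul_assoc I J N

theorem smul_smul_comm_subspace {I J : Submodule ℂ A} (h : ∀ a ∈ I, ∀ b ∈ J, Commute a b)
    (N : Submodule ℂ M) : I • J • N = J • I • N := by
  rw [← mul_smul_subspace, ← mul_smul_subspace, Submodule.mul_comm_of_commute h]

theorem top_smul_eq_top {s : Set M} (hs : Submodule.span A s = ⊤) {V : Submodule ℂ M}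
    (hV : s ⊆ V) : (⊤ : Submodule ℂ A) • V = ⊤ := by
  refine top_unique fun m _ => ?_
  have hm : m ∈ Submodule.span A s := by rw [hs]; trivial
  refine Submodule.span_induction ?_ ?_ ?_ ?_ hm
  · intro x hx
    rw [← one_smul A x]
    exact Submodule.smul_mem_smul trivial (hV hx)
  · exact zero_mem _
  · exact fun x y _ _ hx hy => add_mem hx hy
  · intro r x _ hx
    refine Submodule.smul_induction_on hx (fun a _ v hv => ?_) fun a b ha hb => ?_
    · rw [smul_smul]
      exact Submodule.smul_mem_smul trivial hv
    · rw [smul_add]; exact add_mem ha hb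

theorem exists_pow_smul_eq_zero {d : A} (hd : ∀ m : M, ∃ n : ℕ, d ^ n • m = 0)
    {V : Submodule ℂ M} (hV : V.FG) : ∃ n : ℕ, ∀ v ∈ V, d ^ n • v = 0 := by
  obtain ⟨s, rfl⟩ := hV
  choose n hn using hd
  refine ⟨s.sup n, fun v hv => ?_⟩
  refine Submodule.span_induction ?_ ?_ ?_ ?_ hv
  · intro x hx
    rw [← Nat.sub_add_cancel (Finset.le_sup hx : n x ≤ s.sup n), pow_add, mul_smul, hn, smul_zero]
  · simp
  · intro x y _ _ hx hy
    rw [smul_add, hx, hy, add_zero]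
  · intro r x _ hx
    rw [smul_algebra_smul_comm, hx, smul_zero]

/-- Finitely many commuting locally nilpotent elements are simultaneously locally finite. -/
theorem exists_fg_stable (s : Finset A) (hcomm : ∀ a ∈ s, ∀ b ∈ s, a * b = b * a)
    (hnil : ∀ a ∈ s, ∀ m : M, ∃ n : ℕ, a ^ n • m = 0) {V : Submodule ℂ M} (hV : V.FG) :
    ∃ V' : Submodule ℂ M, V ≤ V' ∧ V'.FG ∧ ∀ a ∈ s, ∀ v ∈ V', a • v ∈ V' := by
  classical
  induction s using Finset.induction_on with
  | empty => exact ⟨V, le_rfl, hV, by simp⟩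
  | insert d s _ ih =>
    obtain ⟨V', hVV', hV', hst⟩ := ih
      (fun a ha b hb => hcomm a (Finset.mem_insert_of_mem ha) b (Finset.mem_insert_of_mem hb))
      fun a ha => hnil a (Finset.mem_insert_of_mem ha)
    obtain ⟨n, hn⟩ := exists_pow_smul_eq_zero (hnil d (Finset.mem_insert_self d s)) hV'
    let T : Submodule ℂ M :=
      ⨆ k : Fin (n + 1), V'.map (Algebra.lsmul ℂ ℂ M (d ^ (k : ℕ)))
    have hmem : ∀ k : ℕ, ∀ v ∈ V', d ^ k • v ∈ T := by
      intro k v hv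
      by_cases hk : k < n + 1
      · exact Submodule.mem_iSup_of_mem (⟨k, hk⟩ : Fin (n + 1))
          ⟨v, hv, rfl⟩
      · rw [← Nat.sub_add_cancel (by omega : n ≤ k), pow_add, mul_smul, hn v hv, smul_zero]
        exact T.zero_mem
    refine ⟨T, fun v hv => by simpa using hmem 0 v (hVV' hv),
      Submodule.fg_iSup _ fun k => hV'.map _, fun a ha => ?_⟩
    have hle : T ≤ T.comap (Algebra.lsmul ℂ ℂ M a) := by
      refine iSup_le fun k => ?_
      rintro _ ⟨v, hv, rfl⟩
      rw [Submodule.mem_comap]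
      simp only [Algebra.lsmul_coe]
      rcases Finset.mem_insert.1 ha with rfl | has
      · rw [smul_smul, ← pow_succ']
        exact hmem _ v hv
      · have hc : Commute a (d ^ (k : ℕ)) :=
          Commute.pow_right (hcomm a ha d (Finset.mem_insert_self d s)) _
        rw [smul_smul, hc.eq, mul_smul]
        exact hmem _ _ (hst a has v hv)
    exact fun v hv => hle hv

/-- The image of an algebra homomorphism, as a subspace. -/
def img {R : Type*} [Ring R] [Algebra ℂ R] (φ : R →ₐ[ℂ] A) : Submodule ℂ A :=
  Submodule.map φ.toLinearMap ⊤

theorem mem_img {R : Type*} [Ring R] [Algebra ℂ R] (φ : R →ₐ[ℂ] A) (p : R) : φ p ∈ img φ :=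
  ⟨p, trivial, rfl⟩

theorem img_mul_self {R : Type*} [Ring R] [Algebra ℂ R] (φ : R →ₐ[ℂ] A) :
    img φ * img φ = img φ := by
  rw [img, ← Submodule.map_mul]
  congr 1
  exact top_unique fun p _ => by
    rw [← mul_one p]; exact Submodule.mul_mem_mul trivial trivial

theorem img_eq_adjoin {ι : Type*} (φ : MvPolynomial ι ℂ →ₐ[ℂ] A) :
    img φ = Subalgebra.toSubmodule (Algebra.adjoin ℂ (Set.range fun i => φ (X i))) := by
  have : (Set.range fun i => φ (X i)) = φ '' Set.range X := by
    rw [← Set.range_comp]; rfl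
  rw [this, ← AlgHom.map_adjoin, MvPolynomial.adjoin_range_X]
  rfl

end Subspaces

/-! ### Trading one of two commuting polynomial actions for the other. -/

section Diagonal

variable {ι G S : Type*} [Fintype ι] [DecidableEq ι] [Group G] [Finite G]
  (𝒟 : ReflectionDatum ι G S)
  {A M : Type*} [Ring A] [Algebra ℂ A] [AddCommGroup M] [Module ℂ M] [Module A M]
  [IsScalarTower ℂ A M]

/-- Two commuting actions of polynomials whose difference is locally nilpotent on invariants: a
finitely generated space for both is finitely generated for one of them. -/
theorem exists_fg_smul_smul_le (φ ψ : MvPolynomial ι ℂ →ₐ[ℂ] A)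
    (hcomm : ∀ p q, Commute (φ p) (ψ q))
    (hnil : ∀ p ∈ 𝒟.invariants, ∀ m : M, ∃ n : ℕ, (φ p - ψ p) ^ n • m = 0)
    {V : Submodule ℂ M} (hV : V.FG) :
    ∃ V' : Submodule ℂ M, V'.FG ∧ img φ • img ψ • V ≤ img ψ • V' := by
  classical
  obtain ⟨F, hF, hFI⟩ := 𝒟.exists_fg_mul_invariants
  obtain ⟨s, hs⟩ := 𝒟.fg_invariants
  have hφφ : ∀ p q, Commute (φ p) (φ q) := fun p q => (Commute.all p q).map φ
  have hψψ : ∀ p q, Commute (ψ p) (ψ q) := fun p q => (Commute.all p q).map ψ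
  obtain ⟨V', hVV', hV', hst⟩ := exists_fg_stable (s.image fun p => φ p - ψ p)
    (by
      intro a ha b hb
      obtain ⟨p, _, rfl⟩ := Finset.mem_image.1 ha
      obtain ⟨q, _, rfl⟩ := Finset.mem_image.1 hb
      exact (((hφφ p q).sub_right (hcomm p q)).sub_left
        ((hcomm q p).symm.sub_right (hψψ p q))).eq)
    (by
      intro a ha
      obtain ⟨p, hp, rfl⟩ := Finset.mem_image.1 ha
      refine hnil p ?_
      rw [← hs]
      exact Algebra.subset_adjoin hp) hV
  set I := Subalgebra.toSubmodule 𝒟.invariants with hI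
  -- On invariant generators, `φ p = ψ p + (φ p - ψ p)` and the difference preserves `V'`; hence `K`
  -- is stable under `φ` of all invariants. The finite set `F` of module generators then accounts
  -- for the remaining polynomials.
  set K := I.map ψ.toLinearMap • V' with hK
  have hmap : ∀ χ : MvPolynomial ι ℂ →ₐ[ℂ] A,
      img χ = F.map χ.toLinearMap * I.map χ.toLinearMap := fun χ => by
    rw [img, ← hFI, Submodule.map_mul]
  have hφK : ∀ p ∈ 𝒟.invariants, ∀ z ∈ K, φ p • z ∈ K := by
    intro p hp
    rw [← hs] at hp
    induction hp using Algebra.adjoin_induction with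
    | mem p hp =>
      have hpI : p ∈ 𝒟.invariants := by rw [← hs]; exact Algebra.subset_adjoin hp
      intro z hz
      refine Submodule.smul_induction_on hz ?_ fun a b ha hb => ?_
      · rintro _ ⟨q, hq, rfl⟩ v hv
        change φ p • ψ q • v ∈ K
        have : φ p • ψ q • v = ψ q • (φ p - ψ p) • v + ψ (q * p) • v := by
          rw [smul_smul, (hcomm p q).eq, mul_smul, sub_smul, smul_sub, map_mul, mul_smul,
            sub_add_cancel]
        rw [this]
        exact add_mem
          (Submodule.smul_mem_smul ⟨q, hq, rfl⟩ (hst _ (Finset.mem_image_of_mem _ hp) v hv))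
          (Submodule.smul_mem_smul ⟨q * p, mul_mem (S := Subalgebra ℂ _) hq hpI, rfl⟩ hv)
      · rw [smul_add]; exact add_mem ha hb
    | algebraMap r =>
      intro z hz
      rw [AlgHom.commutes, algebraMap_smul]
      exact K.smul_mem r hz
    | add p q _ _ hp hq =>
      intro z hz
      rw [map_add, add_smul]; exact add_mem (hp z hz) (hq z hz)
    | mul p q _ _ hp hq =>
      intro z hz
      rw [map_mul, mul_smul]; exact hp _ (hq z hz)
  have hIK : I.map φ.toLinearMap • K ≤ K := by
    rw [Submodule.smul_le]
    rintro _ ⟨p, hp, rfl⟩ z hz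
    exact hφK p hp z hz
  have hc : ∀ P Q : Submodule ℂ (MvPolynomial ι ℂ), ∀ N : Submodule ℂ M,
      P.map φ.toLinearMap • Q.map ψ.toLinearMap • N =
        Q.map ψ.toLinearMap • P.map φ.toLinearMap • N := by
    intro P Q N
    refine smul_smul_comm_subspace ?_ N
    rintro _ ⟨p, _, rfl⟩ _ ⟨q, _, rfl⟩
    exact hcomm p q
  have hKψ : K ≤ img ψ • V' := Submodule.smul_mono_left (Submodule.map_mono le_top)
  refine ⟨F.map φ.toLinearMap • V', fg_smul (hF.map _) hV', ?_⟩
  calc img φ • img ψ • V ≤ img φ • img ψ • V' :=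
        smul_mono_right _ (smul_mono_right _ hVV')
    _ = F.map φ.toLinearMap • F.map ψ.toLinearMap • I.map φ.toLinearMap • K := by
        rw [hmap φ, hmap ψ, mul_smul_subspace, mul_smul_subspace, hc I F]
    _ ≤ F.map φ.toLinearMap • F.map ψ.toLinearMap • img ψ • V' :=
        smul_mono_right _ (smul_mono_right _ (hIK.trans hKψ))
    _ ≤ F.map φ.toLinearMap • img ψ • img ψ • V' :=
        smul_mono_right _ (Submodule.smul_mono_left (Submodule.map_mono le_top))
    _ = img ψ • F.map φ.toLinearMap • V' := by
        rw [← mul_smul_subspace (img ψ), img_mul_self]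
        exact hc F ⊤ V'

end Diagonal

/-- A module over a realization which is generated over polynomials in the coordinates by a
finite-dimensional subspace has finite length. -/
theorem Realization.isFiniteLength_of_fg {ι G S : Type*} [Fintype ι] [DecidableEq ι] [Group G]
    [Finite G] [Fintype S] {𝒟 : ReflectionDatum ι G S} {A : Type*} [Ring A] [Algebra ℂ A]
    (ρ : Realization 𝒟 A) {M : Type*} [AddCommGroup M] [Module ℂ M] [Module A M]
    [IsScalarTower ℂ A M] {V : Submodule ℂ M} (hV : V.FG) (h : img ρ.poly • V = ⊤) :
    IsFiniteLength A M := by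
  let _ : Module (MvPolynomial ι ℂ) M := Module.compHom M ρ.poly.toRingHom
  have hM : ∀ (p : MvPolynomial ι ℂ) (m : M), p • m = ρ.poly p • m := fun _ _ => rfl
  obtain ⟨s, rfl⟩ := hV
  have : Module.Finite (MvPolynomial ι ℂ) M := by
    refine ⟨⟨s, top_unique fun m _ => ?_⟩⟩
    have hm : m ∈ img ρ.poly • Submodule.span ℂ (s : Set M) := by rw [h]; trivial
    refine Submodule.smul_induction_on hm ?_ fun a b ha hb => add_mem ha hb
    rintro _ ⟨p, _, rfl⟩ v hv
    change p • v ∈ _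
    refine Submodule.smul_mem _ _ ?_
    refine Submodule.span_induction ?_ ?_ ?_ ?_ hv
    · exact fun x hx => Submodule.subset_span hx
    · exact zero_mem _
    · exact fun x y _ _ hx hy => add_mem hx hy
    · intro r x _ hx
      have : r • x = (C r : MvPolynomial ι ℂ) • x := by
        rw [hM, ρ.poly_C, algebraMap_smul]
      rw [this]
      exact Submodule.smul_mem _ _ hx
  exact ρ.isFiniteLength hM

end RationalCherednik

namespace RationalCherednik

open MvPolynomial

/-! ### Products and opposites of realizations -/

/-- The product of two reflection data. -/
def ReflectionDatum.prod {ι G S ι' G' S' : Type*} [Fintype ι] [DecidableEq ι] [Group G]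
    [Fintype ι'] [DecidableEq ι'] [Group G'] (𝒟 : ReflectionDatum ι G S)
    (𝒟' : ReflectionDatum ι' G' S') : ReflectionDatum (ι ⊕ ι') (G × G') (S ⊕ S') where
  mat :=
    { toFun := fun g => Matrix.fromBlocks (𝒟.mat g.1) 0 0 (𝒟'.mat g.2)
      map_one' := by simp [Matrix.fromBlocks_one]
      map_mul' := fun g h => by simp [Matrix.fromBlocks_multiply] }
  refl := Sum.elim (fun s => (𝒟.refl s, 1)) fun s => (1, 𝒟'.refl s)
  refl_inv := by rintro (s | s) <;> simp [ReflectionDatum.refl_inv]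
  root := Sum.elim (fun s => Sum.elim (𝒟.root s) 0) fun s => Sum.elim 0 (𝒟'.root s)
  scale := Sum.elim 𝒟.scale 𝒟'.scale
  param := Sum.elim 𝒟.param 𝒟'.param
  mat_refl := by
    rintro (s | s) (i | i) (j | j) <;>
      simp [ReflectionDatum.mat_refl, Matrix.one_apply]
  scale_root := by rintro (s | s) <;> simp [ReflectionDatum.scale_root]

/-- The tensor product of two multiplicative maps. -/
def tensorMap {G G' A B : Type*} [Group G] [Group G'] [Ring A] [Algebra ℂ A] [Ring B]
    [Algebra ℂ B] (w : G →* A) (w' : G' →* B) : G × G' →* A ⊗[ℂ] B where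
  toFun g := w g.1 ⊗ₜ w' g.2
  map_one' := by simp [Algebra.TensorProduct.one_def]
  map_mul' g h := by simp

@[simp] theorem tensorMap_apply {G G' A B : Type*} [Group G] [Group G'] [Ring A] [Algebra ℂ A]
    [Ring B] [Algebra ℂ B] (w : G →* A) (w' : G' →* B) (g : G × G') :
    tensorMap w w' g = w g.1 ⊗ₜ w' g.2 := rfl

/-- The tensor product of two realizations. -/
def Realization.tensor {ι G S ι' G' S' : Type*} [Fintype ι] [DecidableEq ι] [Group G] [Fintype S]
    [Fintype ι'] [DecidableEq ι'] [Group G'] [Fintype S'] {𝒟 : ReflectionDatum ι G S}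
    {𝒟' : ReflectionDatum ι' G' S'} {A B : Type*} [Ring A] [Algebra ℂ A] [Ring B] [Algebra ℂ B]
    (ρ : Realization 𝒟 A) (ρ' : Realization 𝒟' B) : Realization (𝒟.prod 𝒟') (A ⊗[ℂ] B) where
  x := Sum.elim (fun i => ρ.x i ⊗ₜ 1) fun i => 1 ⊗ₜ ρ'.x i
  y := Sum.elim (fun i => ρ.y i ⊗ₜ 1) fun i => 1 ⊗ₜ ρ'.y i
  w := tensorMap ρ.w ρ'.w
  x_comm := by
    rintro (i | i) (j | j)
    · simp [ρ.x_comm i j]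
    · simp
    · simp
    · simp [ρ'.x_comm i j]
  w_x := by
    rintro ⟨g, h⟩ (j | j)
    · simp [ReflectionDatum.prod, ρ.w_x, TensorProduct.sum_tmul, ← TensorProduct.smul_tmul']
    · simp [ReflectionDatum.prod, ρ'.w_x, TensorProduct.tmul_sum]
  y_x := by
    rintro (i | i) (j | j)
    · simp only [Sum.elim_inl, Algebra.TensorProduct.tmul_mul_tmul, mul_one,
        ← TensorProduct.sub_tmul, ρ.y_x]
      simp only [ReflectionDatum.prod, Fintype.sum_sum_type]
      by_cases h : i = j <;>
        simp [h, TensorProduct.add_tmul, TensorProduct.sum_tmul, ← TensorProduct.smul_tmul',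
          Algebra.TensorProduct.one_def]
    · simp [ReflectionDatum.prod]
    · simp [ReflectionDatum.prod]
    · simp only [Sum.elim_inr, Algebra.TensorProduct.tmul_mul_tmul, mul_one,
        ← TensorProduct.tmul_sub, ρ'.y_x]
      simp only [ReflectionDatum.prod, Fintype.sum_sum_type]
      by_cases h : i = j <;>
        simp [h, TensorProduct.tmul_add, TensorProduct.tmul_sum, Algebra.TensorProduct.one_def]

/-- The group in the opposite algebra, through inverses. -/
def oppMap {G A : Type*} [Group G] [Ring A] (w : G →* A) : G →* Aᵐᵒᵖ where
  toFun g := MulOpposite.op (w g⁻¹)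
  map_one' := by simp
  map_mul' g h := by simp [← MulOpposite.op_mul]

@[simp] theorem oppMap_apply {G A : Type*} [Group G] [Ring A] (w : G →* A) (g : G) :
    oppMap w g = MulOpposite.op (w g⁻¹) := rfl

/-- Passing to the opposite algebra inverts the relation, and the inverse in `oppMap` inverts it
back, so the same matrices appear. -/
theorem op_w_mul_op {ι G S A : Type*} [Fintype ι] [DecidableEq ι] [Group G] [Ring A]
    [Algebra ℂ A] {𝒟 : ReflectionDatum ι G S} {w : G →* A} {z : ι → A}
    (h : ∀ g j, w g * z j = ∑ i, 𝒟.mat g i j • (z i * w g)) (g : G) (j : ι) :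
    oppMap w g * MulOpposite.op (z j) =
      ∑ i, 𝒟.mat g i j • (MulOpposite.op (z i) * oppMap w g) := by
  simp only [oppMap_apply, ← MulOpposite.op_mul, ← MulOpposite.op_smul, ← Finset.op_sum]
  congr 1
  simp only [h, Finset.smul_sum, smul_smul]
  rw [Finset.sum_comm]
  have e : ∀ l, ∑ i, 𝒟.mat g i j * 𝒟.mat g⁻¹ l i = if l = j then 1 else 0 := by
    intro l
    have : (𝒟.mat g⁻¹ * 𝒟.mat g) l j = (1 : Matrix ι ι ℂ) l j := by rw [← map_mul]; simp
    rw [Matrix.mul_apply, Matrix.one_apply] at this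
    rw [← this]
    exact Finset.sum_congr rfl fun i _ => mul_comm _ _
  simp [← Finset.sum_smul, e]

theorem op_algHom_eq {ι A : Type*} [Ring A] [Algebra ℂ A] {φ : MvPolynomial ι ℂ →ₐ[ℂ] A}
    {ψ : MvPolynomial ι ℂ →ₐ[ℂ] Aᵐᵒᵖ}
    (h : ∀ i, ψ (X i) = MulOpposite.op (φ (X i))) (p : MvPolynomial ι ℂ) :
    ψ p = MulOpposite.op (φ p) := by
  induction p using MvPolynomial.induction_on with
  | C a => simp [MvPolynomial.algHom_C]
  | add p q hp hq => rw [map_add, map_add, hp, hq]; rfl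
  | mul_X p j hp => rw [map_mul, mul_comm p, map_mul, hp, h, MulOpposite.op_mul]

theorem sub_pow_smul_eq_zero_comm {B M : Type*} [Ring B] [AddCommGroup M] [Module B M] {u v : B}
    {n : ℕ} {m : M} (h : (u - v) ^ n • m = 0) : (v - u) ^ n • m = 0 := by
  rw [← neg_sub, neg_pow, mul_smul, h, smul_zero]

theorem img_comp {ι B C : Type*} [Ring B] [Algebra ℂ B] [Ring C] [Algebra ℂ C] (f : B →ₐ[ℂ] C)
    (φ : MvPolynomial ι ℂ →ₐ[ℂ] B) : img (f.comp φ) = (img φ).map f.toLinearMap := by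
  rw [img, img, ← Submodule.map_comp]
  rfl

/-- A realization in an algebra generated by it, in which also the momenta commute and transform
like the coordinates. -/
structure FullRealization {ι G S : Type*} [Fintype ι] [DecidableEq ι] [Group G] [Fintype S]
    (𝒟 : ReflectionDatum ι G S) (A : Type*) [Ring A] [Algebra ℂ A] extends Realization 𝒟 A where
  y_comm : ∀ i j, y i * y j = y j * y i
  w_y : ∀ g j, w g * y j = ∑ i, 𝒟.mat g i j • (y i * w g)
  adjoin_eq_top : Algebra.adjoin ℂ (Set.range x ∪ Set.range y ∪ Set.range w) = ⊤

namespace FullRealization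

variable {ι G S : Type*} [Fintype ι] [DecidableEq ι] [Group G] [Fintype S]
  {𝒟 : ReflectionDatum ι G S} {A : Type*} [Ring A] [Algebra ℂ A] (ρ : FullRealization 𝒟 A)

/-- Polynomials in the momenta. -/
def ypoly : MvPolynomial ι ℂ →ₐ[ℂ] A := (exists_algHom_of_commute ρ.y ρ.y_comm).choose

@[simp] theorem ypoly_X (i : ι) : ρ.ypoly (X i) = ρ.y i :=
  (exists_algHom_of_commute ρ.y ρ.y_comm).choose_spec i

theorem w_ypoly (g : G) (p : MvPolynomial ι ℂ) :
    ρ.w g * ρ.ypoly p = ρ.ypoly (𝒟.subst g p) * ρ.w g :=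
  𝒟.mul_algHom_eq (fun j => by simpa using ρ.w_y g j) p

/-- The span of the group. -/
def wspan : Submodule ℂ A := Submodule.span ℂ (Set.range ρ.w)

theorem fg_wspan [Finite G] : ρ.wspan.FG := Submodule.fg_span (Set.finite_range _)

theorem exists_w_mul_x (g : G) (j : ι) :
    ∃ a ∈ Algebra.adjoin ℂ (Set.range ρ.x), ρ.w g * ρ.x j = a * ρ.w g := by
  refine ⟨∑ i, 𝒟.mat g i j • ρ.x i, sum_mem fun i _ =>
    Subalgebra.smul_mem _ (Algebra.subset_adjoin (Set.mem_range_self i)) _, ?_⟩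
  simp [ρ.w_x, Finset.sum_mul]

theorem exists_w_mul_y (g : G) (j : ι) :
    ∃ a ∈ Algebra.adjoin ℂ (Set.range ρ.y), ρ.w g * ρ.y j = a * ρ.w g := by
  refine ⟨∑ i, 𝒟.mat g i j • ρ.y i, sum_mem fun i _ =>
    Subalgebra.smul_mem _ (Algebra.subset_adjoin (Set.mem_range_self i)) _, ?_⟩
  simp [ρ.w_y, Finset.sum_mul]

theorem y_x_mem (i j : ι) : ρ.y i * ρ.x j - ρ.x j * ρ.y i ∈ ρ.wspan := by
  rw [ρ.y_x]
  refine add_mem ?_ (sum_mem fun s _ =>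
    Submodule.smul_mem _ _ (Submodule.subset_span ⟨_, rfl⟩))
  split_ifs
  · exact Submodule.subset_span ⟨1, map_one _⟩
  · exact zero_mem _

theorem img_poly : img ρ.poly = Subalgebra.toSubmodule (Algebra.adjoin ℂ (Set.range ρ.x)) := by
  simp [img_eq_adjoin]

theorem img_ypoly : img ρ.ypoly = Subalgebra.toSubmodule (Algebra.adjoin ℂ (Set.range ρ.y)) := by
  simp [img_eq_adjoin]

theorem img_poly_mul_img_ypoly : img ρ.poly * ρ.wspan * img ρ.ypoly = ⊤ := by
  rw [img_poly, img_ypoly]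
  exact adjoin_mul_span_mul_adjoin_eq_top ρ.exists_w_mul_x ρ.exists_w_mul_y ρ.y_x_mem
    ρ.adjoin_eq_top

theorem img_ypoly_mul_img_poly : img ρ.ypoly * ρ.wspan * img ρ.poly = ⊤ := by
  rw [img_poly, img_ypoly]
  refine adjoin_mul_span_mul_adjoin_eq_top ρ.exists_w_mul_y ρ.exists_w_mul_x (fun i j => ?_) ?_
  · rw [← neg_sub]
    exact neg_mem (ρ.y_x_mem j i)
  · rw [Set.union_comm (Set.range ρ.y)]
    exact ρ.adjoin_eq_top

theorem wspan_mul_img_poly_le : ρ.wspan * img ρ.poly ≤ img ρ.poly * ρ.wspan := by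
  rw [Submodule.mul_le]
  rintro c hc _ ⟨p, _, rfl⟩
  refine Submodule.span_induction ?_ ?_ ?_ ?_ hc
  · rintro _ ⟨g, rfl⟩
    change ρ.w g * ρ.poly p ∈ _
    rw [ρ.w_poly]
    exact Submodule.mul_mem_mul (mem_img _ _) (Submodule.subset_span ⟨g, rfl⟩)
  · simp
  · intro c c' _ _ h h'
    rw [add_mul]; exact add_mem h h'
  · intro r c _ h
    rw [smul_mul_assoc]; exact Submodule.smul_mem _ _ h

open MulOpposite in
/-- The realization in the opposite algebra for which coordinates and momenta are exchanged. -/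
def opp : FullRealization 𝒟 Aᵐᵒᵖ where
  x i := op (ρ.y i)
  y i := op (ρ.x i)
  w := oppMap ρ.w
  x_comm i j := by rw [← op_mul, ← op_mul, ρ.y_comm]
  y_comm i j := by rw [← op_mul, ← op_mul, ρ.x_comm]
  w_x := op_w_mul_op ρ.w_y
  w_y := op_w_mul_op ρ.w_x
  y_x i j := by
    rw [← op_mul, ← op_mul, ← op_sub, ρ.y_x]
    -- Reversing products and exchanging `x` with `y` both change the sign of the commutator,
    -- leaving only `i` and `j` swapped; the right side is symmetric in them, and reflections are
    -- involutions.
    simp only [eq_comm (a := j), op_add, oppMap_apply, 𝒟.refl_inv]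
    congr 1
    · split_ifs <;> rfl
    · rw [Finset.op_sum]
      refine Finset.sum_congr rfl fun s _ => ?_
      rw [op_smul]
      congr 1
      ring
  adjoin_eq_top := by
    have key : ∀ a ∈ Algebra.adjoin ℂ (Set.range ρ.x ∪ Set.range ρ.y ∪ Set.range ρ.w),
        op a ∈ Algebra.adjoin ℂ (Set.range (fun i => op (ρ.y i)) ∪
          Set.range (fun i => op (ρ.x i)) ∪ Set.range (oppMap ρ.w)) := by
      intro a ha
      induction ha using Algebra.adjoin_induction with
      | mem a ha =>
        refine Algebra.subset_adjoin ?_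
        rcases ha with (⟨j, rfl⟩ | ⟨j, rfl⟩) | ⟨g, rfl⟩
        · exact Or.inl (Or.inr ⟨j, rfl⟩)
        · exact Or.inl (Or.inl ⟨j, rfl⟩)
        · exact Or.inr ⟨g⁻¹, by simp⟩
      | algebraMap r => exact algebraMap_mem _ r
      | add a b _ _ ha hb => rw [op_add]; exact add_mem ha hb
      | mul a b _ _ ha hb => rw [op_mul]; exact mul_mem hb ha
    refine top_unique fun a _ => ?_
    exact key a.unop (by rw [ρ.adjoin_eq_top]; trivial)

theorem opp_poly (p : MvPolynomial ι ℂ) : ρ.opp.poly p = MulOpposite.op (ρ.ypoly p) :=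
  op_algHom_eq (fun i => by rw [Realization.poly_X, ypoly_X]; rfl) p

theorem opp_ypoly (p : MvPolynomial ι ℂ) : ρ.opp.ypoly p = MulOpposite.op (ρ.poly p) :=
  op_algHom_eq (fun i => by rw [Realization.poly_X, ypoly_X]; rfl) p

/-! ### Modules and bimodules -/

section Modules

variable [Finite G] {M : Type*} [AddCommGroup M] [Module ℂ M]

/-- A module generated by a finite-dimensional subspace which is stable under the invariant
polynomials in the momenta has finite length. -/
theorem isFiniteLength_of_stable [Module A M] [IsScalarTower ℂ A M] {V : Submodule ℂ M}
    (hV : V.FG) (hgen : (⊤ : Submodule ℂ A) • V = ⊤)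
    (hst : ∀ p ∈ 𝒟.invariants, ∀ v ∈ V, ρ.ypoly p • v ∈ V) : IsFiniteLength A M := by
  obtain ⟨F, hF, hFI⟩ := 𝒟.exists_fg_mul_invariants
  have h1 : img ρ.ypoly • V ≤ F.map ρ.ypoly.toLinearMap • V := by
    rw [img, ← hFI, Submodule.map_mul, mul_smul_subspace]
    refine smul_mono_right _ (Submodule.smul_le.2 ?_)
    rintro _ ⟨p, hp, rfl⟩ v hv
    exact hst p hp v hv
  refine ρ.toRealization.isFiniteLength_of_fg
    (fg_smul ρ.fg_wspan (fg_smul (hF.map ρ.ypoly.toLinearMap) hV)) (top_unique ?_)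
  rw [← hgen, ← ρ.img_poly_mul_img_ypoly, mul_smul_subspace, mul_smul_subspace]
  exact smul_mono_right _ (smul_mono_right _ h1)

/-- A finitely generated bimodule on which the difference of the left and right actions is locally
nilpotent, for the invariant polynomials both in the coordinates and in the momenta, has finite
length. -/
theorem isFiniteLength_bimodule [Module (A ⊗[ℂ] Aᵐᵒᵖ) M] [IsScalarTower ℂ (A ⊗[ℂ] Aᵐᵒᵖ) M]
    (hfin : Module.Finite (A ⊗[ℂ] Aᵐᵒᵖ) M)
    (hx : ∀ p ∈ 𝒟.invariants, ∀ m : M, ∃ n : ℕ,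
      (ρ.poly p ⊗ₜ[ℂ] 1 - 1 ⊗ₜ[ℂ] MulOpposite.op (ρ.poly p) : A ⊗[ℂ] Aᵐᵒᵖ) ^ n • m = 0)
    (hy : ∀ p ∈ 𝒟.invariants, ∀ m : M, ∃ n : ℕ,
      (ρ.ypoly p ⊗ₜ[ℂ] 1 - 1 ⊗ₜ[ℂ] MulOpposite.op (ρ.ypoly p) : A ⊗[ℂ] Aᵐᵒᵖ) ^ n • m = 0) :
    IsFiniteLength (A ⊗[ℂ] Aᵐᵒᵖ) M := by
  let L : A →ₐ[ℂ] A ⊗[ℂ] Aᵐᵒᵖ := Algebra.TensorProduct.includeLeft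
  let R : Aᵐᵒᵖ →ₐ[ℂ] A ⊗[ℂ] Aᵐᵒᵖ := Algebra.TensorProduct.includeRight
  have hLR : ∀ a b, Commute (L a) (R b) := fun a b => by
    simp [Commute, SemiconjBy, L, R]
  have hcomm : ∀ (P : Submodule ℂ A) (Q : Submodule ℂ Aᵐᵒᵖ) (N : Submodule ℂ M),
      P.map L.toLinearMap • Q.map R.toLinearMap • N =
        Q.map R.toLinearMap • P.map L.toLinearMap • N := by
    intro P Q N
    refine smul_smul_comm_subspace ?_ N
    rintro _ ⟨p, _, rfl⟩ _ ⟨q, _, rfl⟩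
    exact hLR p q
  have htop : (⊤ : Submodule ℂ A).map L.toLinearMap * (⊤ : Submodule ℂ Aᵐᵒᵖ).map R.toLinearMap
      = ⊤ := by
    refine top_unique fun t _ => ?_
    induction t using TensorProduct.induction_on with
    | zero => exact zero_mem _
    | tmul a b =>
      have : a ⊗ₜ[ℂ] b = L a * R b := by simp [L, R]
      rw [this]
      exact Submodule.mul_mem_mul ⟨a, trivial, rfl⟩ ⟨b, trivial, rfl⟩
    | add s t hs ht => exact add_mem (hs trivial) (ht trivial)
  set ρ' := ρ.opp with hρ'
  obtain ⟨s, hs⟩ := hfin.fg_top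
  set V : Submodule ℂ M := Submodule.span ℂ s with hV
  have hVtop : (⊤ : Submodule ℂ (A ⊗[ℂ] Aᵐᵒᵖ)) • V = ⊤ :=
    top_smul_eq_top hs Submodule.subset_span
  -- Left momenta are absorbed by right momenta, which are the coordinates of `ρ'`; `h₂` then
  -- absorbs right x into left x.
  obtain ⟨V₁, hV₁, h₁⟩ := exists_fg_smul_smul_le 𝒟 (L.comp ρ.ypoly) (R.comp ρ'.poly)
    (fun p q => hLR _ _) (fun p hp => by
      simpa [L, R, hρ', opp_poly] using hy p hp) (V := V) ⟨s, rfl⟩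
  obtain ⟨V₂, hV₂, h₂⟩ := exists_fg_smul_smul_le 𝒟 (R.comp ρ'.ypoly) (L.comp ρ.poly)
    (fun p q => (hLR _ _).symm) (fun p hp m => by
      obtain ⟨n, hn⟩ := hx p hp m
      refine ⟨n, ?_⟩
      refine sub_pow_smul_eq_zero_comm ?_
      simpa [L, R, hρ', opp_ypoly] using hn) hV₁
  set Xl := (img ρ.poly).map L.toLinearMap with hXl
  set Yl := (img ρ.ypoly).map L.toLinearMap with hYl
  set Wl := ρ.wspan.map L.toLinearMap with hWl
  set Xr := (img ρ'.poly).map R.toLinearMap with hXr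
  set Yr := (img ρ'.ypoly).map R.toLinearMap with hYr
  set Wr := ρ'.wspan.map R.toLinearMap with hWr
  simp only [img_comp] at h₁ h₂
  have hLtop : (⊤ : Submodule ℂ A).map L.toLinearMap = Xl * Wl * Yl := by
    rw [← ρ.img_poly_mul_img_ypoly, Submodule.map_mul, Submodule.map_mul]
  have hRtop : (⊤ : Submodule ℂ Aᵐᵒᵖ).map R.toLinearMap = Yr * Wr * Xr := by
    rw [← ρ'.img_ypoly_mul_img_poly, Submodule.map_mul, Submodule.map_mul]
  have hRtop' : (⊤ : Submodule ℂ Aᵐᵒᵖ).map R.toLinearMap = Xr * Wr * Yr := by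
    rw [← ρ'.img_poly_mul_img_ypoly, Submodule.map_mul, Submodule.map_mul]
  have hXX : Xl * Xl = Xl := by rw [hXl, ← Submodule.map_mul, img_mul_self]
  have hWX : Wl * Xl ≤ Xl * Wl := by
    rw [hXl, hWl, ← Submodule.map_mul, ← Submodule.map_mul]
    exact Submodule.map_mono ρ.wspan_mul_img_poly_le
  have hle1 : V₁ ≤ Xl • V₁ := fun v hv => by
    rw [← one_smul (A ⊗[ℂ] Aᵐᵒᵖ) v]
    refine Submodule.smul_mem_smul ⟨1, ?_, map_one L⟩ hv
    rw [← map_one ρ.poly]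
    exact mem_img _ _
  -- The right algebra is first written as `Yr Wr Xr`, so that `Yl` meets `Xr V` and is absorbed,
  -- and then as `Xr Wr Yr`, so that `Yr` meets `Xl V₁` and is absorbed.
  have hmain : (⊤ : Submodule ℂ M) ≤ (Xl * Xr) • (Wl • Wr • V₂) := by
    calc (⊤ : Submodule ℂ M) = Xl • Wl • Yl • Yr • Wr • Xr • V := by
          rw [← hVtop, ← htop, hLtop, hRtop]
          simp only [mul_smul_subspace]
      _ = Xl • Wl • Yr • Wr • Yl • Xr • V := by
          rw [hcomm (img ρ.ypoly), hcomm (img ρ.ypoly)]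
      _ ≤ Xl • Wl • Yr • Wr • Xr • V₁ := by gcongr
      _ = Xl • Wl • Xr • Wr • Yr • V₁ := by
          rw [← mul_smul_subspace Wr, ← mul_smul_subspace Yr, ← mul_assoc, ← hRtop, hRtop']
          simp only [mul_smul_subspace]
      _ ≤ Xl • Wl • Xr • Wr • Yr • Xl • V₁ := by gcongr
      _ ≤ Xl • Wl • Xr • Wr • Xl • V₂ := by gcongr
      _ = Xl • (Wl * Xl) • Xr • Wr • V₂ := by
          rw [← hcomm (img ρ.poly), ← hcomm (img ρ.poly), mul_smul_subspace]
      _ ≤ Xl • (Xl * Wl) • Xr • Wr • V₂ :=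
          smul_mono_right _ (Submodule.smul_mono_left hWX)
      _ = (Xl * Xl) • Wl • Xr • Wr • V₂ := by simp only [mul_smul_subspace]
      _ = (Xl * Xr) • (Wl • Wr • V₂) := by
          rw [hXX, hcomm ρ.wspan, mul_smul_subspace]
  have hpl : ∀ p, (ρ.toRealization.tensor ρ'.toRealization).poly (rename Sum.inl p) =
      L (ρ.poly p) := by
    intro p
    have : ((ρ.toRealization.tensor ρ'.toRealization).poly.comp (rename Sum.inl)) =
        L.comp ρ.poly := by
      apply MvPolynomial.algHom_ext
      intro i
      simp [L, Realization.tensor]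
    exact DFunLike.congr_fun this p
  have hpr : ∀ p, (ρ.toRealization.tensor ρ'.toRealization).poly (rename Sum.inr p) =
      R (ρ'.poly p) := by
    intro p
    have : ((ρ.toRealization.tensor ρ'.toRealization).poly.comp (rename Sum.inr)) =
        R.comp ρ'.poly := by
      apply MvPolynomial.algHom_ext
      intro i
      simp [R, Realization.tensor]
    exact DFunLike.congr_fun this p
  have hXlr : Xl * Xr ≤ img (ρ.toRealization.tensor ρ'.toRealization).poly := by
    rw [← img_mul_self, Submodule.mul_le]
    rintro _ ⟨_, ⟨p, _, rfl⟩, rfl⟩ _ ⟨_, ⟨q, _, rfl⟩, rfl⟩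
    refine Submodule.mul_mem_mul ?_ ?_
    · exact ⟨_, trivial, hpl p⟩
    · exact ⟨_, trivial, hpr q⟩
  exact (ρ.toRealization.tensor ρ'.toRealization).isFiniteLength_of_fg
    (fg_smul (ρ.fg_wspan.map L.toLinearMap) (fg_smul (ρ'.fg_wspan.map R.toLinearMap) hV₂))
    (top_unique (hmain.trans (Submodule.smul_mono_left hXlr)))

end Modules

end FullRealization

end RationalCherednik

namespace RationalCherednik

open MvPolynomial

/-! ### The rational Cherednik algebra -/

section Coordinates

variable {E : Type*} [NormedAddCommGroup E] [InnerProductSpace ℝ E]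

@[simp] theorem rootForm_tmul (v : E) (z : ℂ) (u : E) :
    rootForm v (z ⊗ₜ[ℝ] u) = z * (inner ℝ v u : ℝ) := by
  simp [rootForm, Algebra.smul_def, mul_comm]

@[simp] theorem act_tmul (w : E ≃ₗᵢ[ℝ] E) (z : ℂ) (u : E) : act w (z ⊗ₜ[ℝ] u) = z ⊗ₜ[ℝ] w u := rfl

theorem actDual_rootForm (w : E ≃ₗᵢ[ℝ] E) (v : E) : actDual w (rootForm v) = rootForm (w v) := by
  apply TensorProduct.AlgebraTensorModule.ext
  intro z u
  have : inner ℝ v (w.symm u) = inner ℝ (w v) u := by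
    rw [← w.inner_map_map v (w.symm u), w.apply_symm_apply]
  simp [actDual, this]

theorem rootForm_sum {κ : Type*} (t : Finset κ) (a : κ → ℝ) (v : κ → E) :
    rootForm (∑ i ∈ t, a i • v i) = ∑ i ∈ t, (a i : ℂ) • rootForm (v i) := by
  apply TensorProduct.AlgebraTensorModule.ext
  intro z u
  simp only [rootForm_tmul, sum_inner, inner_smul_left, LinearMap.sum_apply, LinearMap.smul_apply,
    smul_eq_mul, Complex.ofReal_sum, Finset.mul_sum, Complex.ofReal_mul, RCLike.conj_to_real]
  refine Finset.sum_congr rfl fun i _ => ?_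
  ring

variable {ι : Type*} [Fintype ι] (e : OrthonormalBasis ι ℝ E)

theorem eq_sum_rootForm (x : CplxDual E) : x = ∑ i, x (1 ⊗ₜ e i) • rootForm (e i) := by
  apply TensorProduct.AlgebraTensorModule.ext
  intro z u
  have h : z ⊗ₜ[ℝ] u = ∑ i, (z * (inner ℝ (e i) u : ℝ)) • ((1 : ℂ) ⊗ₜ[ℝ] e i) := by
    conv_lhs => rw [← e.sum_repr' u]
    rw [TensorProduct.tmul_sum]
    refine Finset.sum_congr rfl fun i _ => ?_
    rw [TensorProduct.smul_tmul', smul_eq_mul, mul_one, ← TensorProduct.smul_tmul, mul_comm]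
    rfl
  conv_lhs => rw [h]
  simp only [map_sum, map_smul, LinearMap.sum_apply, LinearMap.smul_apply, smul_eq_mul,
    rootForm_tmul]
  exact Finset.sum_congr rfl fun i _ => mul_comm _ _

theorem eq_sum_tmul (y : Cplx E) : y = ∑ i, rootForm (e i) y • ((1 : ℂ) ⊗ₜ[ℝ] e i) := by
  induction y using TensorProduct.induction_on with
  | zero => simp
  | tmul z u =>
    conv_lhs => rw [← e.sum_repr' u]
    rw [TensorProduct.tmul_sum]
    refine Finset.sum_congr rfl fun i _ => ?_
    rw [rootForm_tmul, TensorProduct.smul_tmul', smul_eq_mul, mul_one, ← TensorProduct.smul_tmul,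
      mul_comm]
    rfl
  | add y y' h h' =>
    conv_lhs => rw [h, h', ← Finset.sum_add_distrib]
    refine Finset.sum_congr rfl fun i _ => ?_
    rw [map_add, add_smul]

end Coordinates

section Algebra

variable {E : Type*} [NormedAddCommGroup E] [InnerProductSpace ℝ E]
  (W : Subgroup (E ≃ₗᵢ[ℝ] E)) (α : reflections W → E) (c : reflections W → ℂ)

/-- The quotient map from the free algebra. -/
def mk : FreeAlgebra ℂ (Gen W) →ₐ[ℂ] Cherednik W α c := RingQuot.mkAlgHom ℂ (Rel W α c)

theorem mk_gen (g : Gen W) : mk W α c (gen W g) = of W α c g := rfl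

theorem mk_rel {a b : FreeAlgebra ℂ (Gen W)} (h : Rel W α c a b) : mk W α c a = mk W α c b :=
  RingQuot.mkAlgHom_rel ℂ h

/-- The linear map from `𝔥*` to the algebra. -/
def ofX : CplxDual E →ₗ[ℂ] Cherednik W α c where
  toFun x := of W α c (.x x)
  map_add' x x' := by simpa [mk_gen] using mk_rel W α c (Rel.x_add x x')
  map_smul' a x := by simpa [mk_gen] using mk_rel W α c (Rel.x_smul a x)

/-- The linear map from `𝔥` to the algebra. -/
def ofY : Cplx E →ₗ[ℂ] Cherednik W α c where
  toFun y := of W α c (.y y)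
  map_add' y y' := by simpa [mk_gen] using mk_rel W α c (Rel.y_add y y')
  map_smul' a y := by simpa [mk_gen] using mk_rel W α c (Rel.y_smul a y)

/-- The group homomorphism from `W` to the algebra. -/
def ofW : W →* Cherednik W α c where
  toFun w := of W α c (.w w)
  map_one' := by simpa [mk_gen] using mk_rel W α c Rel.w_one
  map_mul' w w' := by simpa [mk_gen] using mk_rel W α c (Rel.w_mul w w')

theorem ofW_mul_ofX (w : W) (x : CplxDual E) :
    ofW W α c w * ofX W α c x = ofX W α c (actDual w x) * ofW W α c w := by
  have h : ofW W α c w * ofX W α c x * ofW W α c w⁻¹ = ofX W α c (actDual w x) := by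
    have := mk_rel W α c (Rel.w_x w x)
    rwa [map_mul, map_mul] at this
  rw [← h, mul_assoc _ (ofW W α c w⁻¹), ← map_mul, inv_mul_cancel, map_one, mul_one]

theorem ofW_mul_ofY (w : W) (y : Cplx E) :
    ofW W α c w * ofY W α c y = ofY W α c (act w y) * ofW W α c w := by
  have h : ofW W α c w * ofY W α c y * ofW W α c w⁻¹ = ofY W α c (act w y) := by
    have := mk_rel W α c (Rel.w_y w y)
    rwa [map_mul, map_mul] at this
  rw [← h, mul_assoc _ (ofW W α c w⁻¹), ← map_mul, inv_mul_cancel, map_one, mul_one]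

theorem ofX_comm (x x' : CplxDual E) :
    ofX W α c x * ofX W α c x' = ofX W α c x' * ofX W α c x := by
  have := mk_rel W α c (Rel.x_comm x x')
  rwa [map_mul, map_mul] at this

theorem ofY_comm (y y' : Cplx E) :
    ofY W α c y * ofY W α c y' = ofY W α c y' * ofY W α c y := by
  have := mk_rel W α c (Rel.y_comm y y')
  rwa [map_mul, map_mul] at this

theorem ofY_mul_ofX [Fintype (reflections W)] (y : Cplx E) (x : CplxDual E) :
    ofY W α c y * ofX W α c x - ofX W α c x * ofY W α c y = algebraMap ℂ _ (x y) +
      ∑ s : reflections W, (c s * rootForm (α s) y * x (coroot (α s))) • ofW W α c s := by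
  have := mk_rel W α c (Rel.y_x y x)
  rw [finsum_eq_sum_of_fintype, map_sub, map_mul, map_mul, map_add, map_sum, AlgHom.commutes] at this
  simp only [map_smul] at this
  exact this

theorem adjoin_of_eq_top : Algebra.adjoin ℂ (Set.range (of W α c)) = ⊤ := by
  have h : Set.range (of W α c) = mk W α c '' Set.range (FreeAlgebra.ι ℂ) := by
    rw [← Set.range_comp]; rfl
  rw [h, ← AlgHom.map_adjoin, FreeAlgebra.adjoin_range_ι, Algebra.map_top, AlgHom.range_eq_top]
  exact RingQuot.mkAlgHom_surjective ℂ _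

variable {ι : Type*} [Fintype ι] [DecidableEq ι] (e : OrthonormalBasis ι ℝ E)

theorem reflection_apply_eq (v u : E) : (ℝ ∙ v)ᗮ.reflection u =
    u - (2 / inner ℝ v v * inner ℝ v u) • v := by
  rw [Submodule.reflection_orthogonal_apply, Submodule.reflection_singleton_apply, neg_sub,
    ← Nat.cast_smul_eq_nsmul ℝ, smul_smul, real_inner_self_eq_norm_sq]
  congr 2
  push_cast
  simp only [RCLike.ofReal_real_eq_id, id_eq]
  ring

variable {W α} in
theorem IsRootChoice.inv_eq (hα : IsRootChoice W α) (s : reflections W) :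
    (s : W)⁻¹ = s := by
  apply Subtype.ext
  rw [Subgroup.coe_inv, hα.reflection_eq s]
  exact Submodule.reflection_symm

/-- The reflection datum of a finite reflection group, in orthonormal coordinates. -/
def datum (hα : IsRootChoice W α) : ReflectionDatum ι W (reflections W) where
  mat :=
    { toFun := fun g => Matrix.of fun i j => ((inner ℝ (e i) ((g : E ≃ₗᵢ[ℝ] E) (e j)) : ℝ) : ℂ)
      map_one' := by
        ext i j
        simp only [Matrix.one_apply, Matrix.of_apply, OneMemClass.coe_one,
          LinearIsometryEquiv.coe_one, id_eq, e.inner_eq_ite]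
        split_ifs <;> simp
      map_mul' := fun g h => by
        ext i j
        simp only [Matrix.of_apply, Matrix.mul_apply, ← Complex.ofReal_mul, ← Complex.ofReal_sum]
        congr 1
        change inner ℝ (e i) (g.1 (h.1 (e j))) = _
        conv_lhs => rw [← e.sum_repr' (h.1 (e j))]
        simp only [map_sum, map_smul, inner_sum, inner_smul_right]
        exact Finset.sum_congr rfl fun k _ => mul_comm _ _ }
  refl s := s
  refl_inv := hα.inv_eq
  root s i := (inner ℝ (α s) (e i) : ℝ)
  scale s := (2 / inner ℝ (α s) (α s) : ℝ)
  param := c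
  mat_refl s i j := by
    simp only [MonoidHom.coe_mk, OneHom.coe_mk, Matrix.of_apply]
    rw [hα.reflection_eq s, reflection_apply_eq, inner_sub_right, inner_smul_right, e.inner_eq_ite,
      real_inner_comm (α s) (e i)]
    split_ifs <;> push_cast <;> ring
  scale_root s := by
    have h : ∑ i, inner ℝ (α s) (e i) * inner ℝ (α s) (e i) = inner ℝ (α s) (α s) := by
      rw [← e.sum_inner_mul_inner (α s) (α s)]
      exact Finset.sum_congr rfl fun i _ => by rw [real_inner_comm (α s) (e i)]
    have h0 : inner ℝ (α s) (α s) ≠ 0 := inner_self_ne_zero.2 (hα.ne_zero s)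
    simp only [← Complex.ofReal_mul, ← Complex.ofReal_sum, h]
    rw [div_mul_cancel₀ _ h0]
    simp

theorem datum_mat (hα : IsRootChoice W α) (g : W) (i j : ι) :
    (datum W α c e hα).mat g i j = ((inner ℝ (e i) ((g : E ≃ₗᵢ[ℝ] E) (e j)) : ℝ) : ℂ) := rfl

/-- The rational Cherednik algebra in orthonormal coordinates. -/
def cherednikRealization [Fintype (reflections W)] (hα : IsRootChoice W α) :
    FullRealization (datum W α c e hα) (Cherednik W α c) where
  x i := ofX W α c (rootForm (e i))
  y i := ofY W α c (1 ⊗ₜ e i)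
  w := ofW W α c
  x_comm i j := ofX_comm W α c _ _
  y_comm i j := ofY_comm W α c _ _
  w_x g j := by
    rw [ofW_mul_ofX, actDual_rootForm, ← e.sum_repr' ((g : E ≃ₗᵢ[ℝ] E) (e j)), rootForm_sum,
      map_sum, Finset.sum_mul]
    simp only [map_smul, smul_mul_assoc]
    rfl
  w_y g j := by
    rw [ofW_mul_ofY, act_tmul, ← e.sum_repr' ((g : E ≃ₗᵢ[ℝ] E) (e j)), TensorProduct.tmul_sum,
      map_sum, Finset.sum_mul]
    refine Finset.sum_congr rfl fun i _ => ?_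
    rw [datum_mat, ← smul_mul_assoc, ← (ofY W α c).map_smul]
    congr 2
    rw [TensorProduct.smul_tmul', ← TensorProduct.smul_tmul]
    simp
  y_x i j := by
    rw [ofY_mul_ofX]
    congr 1
    · rw [rootForm_tmul, e.inner_eq_ite]
      by_cases h : i = j
      · simp [h]
      · simp [h, Ne.symm h]
    -- The factor `2 / (α, α)` of the coroot is the `scale` of the datum.
    · refine Finset.sum_congr rfl fun s _ => ?_
      congr 1
      simp only [datum, coroot, rootForm_tmul, inner_smul_right, real_inner_comm (α s) (e j)]
      push_cast
      ring
  adjoin_eq_top := by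
    rw [eq_top_iff, ← adjoin_of_eq_top W α c]
    refine Algebra.adjoin_le ?_
    rintro _ ⟨g | g | g, rfl⟩
    · change ofY W α c g ∈ Algebra.adjoin ℂ _
      rw [eq_sum_tmul e g, map_sum]
      refine sum_mem fun i _ => ?_
      rw [map_smul]
      refine Subalgebra.smul_mem _ (Algebra.subset_adjoin ?_) _
      exact Or.inl (Or.inr ⟨i, rfl⟩)
    · change ofX W α c g ∈ Algebra.adjoin ℂ _
      rw [eq_sum_rootForm e g, map_sum]
      refine sum_mem fun i _ => ?_
      rw [map_smul]
      refine Subalgebra.smul_mem _ (Algebra.subset_adjoin ?_) _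
      exact Or.inl (Or.inl ⟨i, rfl⟩)
    · exact Algebra.subset_adjoin (Or.inr ⟨g, rfl⟩)

/-! ### Invariants inside the algebra, and the two finite length statements. -/

variable [Fintype (reflections W)] (hα : IsRootChoice W α)

/-- Moving `w` past a polynomial applies the substitution by `w`, so an invariant polynomial
commutes with `W`. -/
theorem poly_mem_invX {p : MvPolynomial ι ℂ} (hp : p ∈ (datum W α c e hα).invariants) :
    (cherednikRealization W α c e hα).poly p ∈ invX W α c := by
  set ρ := cherednikRealization W α c e hα
  refine ⟨?_, ?_⟩
  · have h : ρ.poly p ∈ img ρ.poly := mem_img _ _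
    rw [ρ.img_poly] at h
    refine Algebra.adjoin_mono ?_ h
    rintro _ ⟨i, rfl⟩
    exact ⟨_, rfl⟩
  · refine Subalgebra.mem_centralizer_iff ℂ |>.2 ?_
    rintro _ ⟨g, rfl⟩
    have := ρ.w_poly g p
    rwa [hp g] at this

theorem ypoly_mem_centralizer {p : MvPolynomial ι ℂ} (hp : p ∈ (datum W α c e hα).invariants) :
    ∀ w ∈ wSet W α c, w * (cherednikRealization W α c e hα).ypoly p =
      (cherednikRealization W α c e hα).ypoly p * w := by
  rintro _ ⟨g, rfl⟩
  have := (cherednikRealization W α c e hα).w_ypoly g p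
  rwa [hp g] at this

theorem ypoly_mem_invY {p : MvPolynomial ι ℂ} (hp : p ∈ (datum W α c e hα).invariants) :
    (cherednikRealization W α c e hα).ypoly p ∈ invY W α c := by
  refine ⟨?_, (Subalgebra.mem_centralizer_iff ℂ).2 (ypoly_mem_centralizer W α c e hα hp)⟩
  set ρ := cherednikRealization W α c e hα
  have h : ρ.ypoly p ∈ img ρ.ypoly := mem_img _ _
  rw [ρ.img_ypoly] at h
  refine Algebra.adjoin_mono ?_ h
  rintro _ ⟨i, rfl⟩
  exact ⟨_, rfl⟩

theorem ypoly_sub_constantCoeff_mem (p : MvPolynomial ι ℂ) :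
    (cherednikRealization W α c e hα).ypoly (p - C (constantCoeff p)) ∈
      NonUnitalAlgebra.adjoin ℂ (ySet W α c) := by
  set ρ := cherednikRealization W α c e hα
  have hy : ∀ i, ρ.y i ∈ NonUnitalAlgebra.adjoin ℂ (ySet W α c) := fun i =>
    NonUnitalAlgebra.subset_adjoin ℂ ⟨_, rfl⟩
  induction p using MvPolynomial.induction_on with
  | C a => simp
  | add p q hp hq =>
    rw [map_add, C_add, add_sub_add_comm, map_add]
    exact add_mem hp hq
  | mul_X p i hp =>
    have : p * X i - C (constantCoeff (p * X i)) =
        (p - C (constantCoeff p)) * X i + constantCoeff p • X i := by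
      rw [map_mul, constantCoeff_X, mul_zero, C_0, smul_eq_C_mul]; ring
    rw [this, map_add, map_mul, map_smul, ρ.ypoly_X]
    exact add_mem (mul_mem hp (hy i)) (SMulMemClass.smul_mem _ (hy i))

theorem ypoly_sub_constantCoeff_mem_Aminus {p : MvPolynomial ι ℂ}
    (hp : p ∈ (datum W α c e hα).invariants) :
    (cherednikRealization W α c e hα).ypoly (p - C (constantCoeff p)) ∈ Aminus W α c :=
  ⟨ypoly_sub_constantCoeff_mem W α c e hα p, NonUnitalSubalgebra.mem_centralizer_iff ℂ |>.2
    (ypoly_mem_centralizer W α c e hα (sub_mem hp (Subalgebra.algebraMap_mem _ _)))⟩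

/-- The sum of the `A⁻`-stable spaces attached to finitely many generators is finite-dimensional,
generating and stable, which is what `isFiniteLength_of_stable` needs. -/
theorem IsCategoryO.isFiniteLength [Finite W] {ι : Type*} [Fintype ι]
    (e : OrthonormalBasis ι ℝ E) (hα : IsRootChoice W α) {M : Type*} [AddCommGroup M] [Module ℂ M]
    [Module (Cherednik W α c) M] [IsScalarTower ℂ (Cherednik W α c) M]
    (hM : IsCategoryO W α c M) : IsFiniteLength (Cherednik W α c) M := by
  classical
  set ρ := cherednikRealization W α c e hα
  obtain ⟨s, hs⟩ := hM.finite.fg_top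
  choose N hfin hmem hst using hM.locallyFinite
  let V : Submodule ℂ M := ⨆ m : s, N m
  have hV : V.FG := Submodule.fg_iSup _ fun m => (Submodule.fg_iff_finiteDimensional _).2 (hfin m)
  have hVst : ∀ a ∈ Aminus W α c, ∀ v ∈ V, a • v ∈ V := by
    intro a ha v hv
    have hle : V ≤ V.comap (Algebra.lsmul ℂ ℂ M a) := iSup_le fun m v hv =>
      Submodule.mem_iSup_of_mem m (hst m a ha v hv)
    exact hle hv
  refine ρ.isFiniteLength_of_stable hV (top_smul_eq_top hs fun m hm =>
    Submodule.mem_iSup_of_mem (⟨m, hm⟩ : s) (hmem m)) fun p hp v hv => ?_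
  -- `A⁻` has no constants; the constant term of `p` acts by a scalar and is added back.
  have h := hVst _ (ypoly_sub_constantCoeff_mem_Aminus W α c e hα hp) v hv
  rw [map_sub, sub_smul, MvPolynomial.algHom_C, algebraMap_smul] at h
  simpa using add_mem h (V.smul_mem (constantCoeff p) hv)

theorem IsHarishChandra.isFiniteLength [Finite W] {ι : Type*} [Fintype ι]
    (e : OrthonormalBasis ι ℝ E) (hα : IsRootChoice W α) {M : Type*} [AddCommGroup M]
    [Module (Env W α c) M] (hM : IsHarishChandra W α c M) : IsFiniteLength (Env W α c) M := by
  classical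
  let _ : Module ℂ M := Module.compHom M (algebraMap ℂ (Env W α c))
  have : IsScalarTower ℂ (Env W α c) M := ⟨fun a b m => by
    change (a • b) • m = algebraMap ℂ (Env W α c) a • b • m
    rw [smul_smul]
    congr 1
    exact Algebra.smul_def a b⟩
  exact (cherednikRealization W α c e hα).isFiniteLength_bimodule hM.finite
    (fun p hp => hM.ad_nilpotent_x _ (poly_mem_invX W α c e hα hp))
    (fun p hp => hM.ad_nilpotent_y _ (ypoly_mem_invY W α c e hα hp))

end Algebra

end RationalCherednik

end

theorem mainTheorem10 {E : Type*} [NormedAddCommGroup E] [InnerProductSpace ℝ E]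
    [FiniteDimensional ℝ E] (W : Subgroup (E ≃ₗᵢ[ℝ] E))
    (hW : RationalCherednik.IsFiniteCoxeter W)
    (α : RationalCherednik.reflections W → E) (hα : RationalCherednik.IsRootChoice W α)
    (c : RationalCherednik.reflections W → ℂ)
    (hc : RationalCherednik.IsInvariantParameter W c) :
    (∀ (M : Type*) [AddCommGroup M] [Module ℂ M] [Module (RationalCherednik.Cherednik W α c) M]
        [IsScalarTower ℂ (RationalCherednik.Cherednik W α c) M],
      RationalCherednik.IsCategoryO W α c M →
        IsFiniteLength (RationalCherednik.Cherednik W α c) M) ∧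
    (∀ (M : Type*) [AddCommGroup M] [Module (RationalCherednik.Env W α c) M],
      RationalCherednik.IsHarishChandra W α c M →
        IsFiniteLength (RationalCherednik.Env W α c) M) := by
  have := hW.finite
  have := Fintype.ofFinite (RationalCherednik.reflections W)
  exact ⟨fun M _ _ _ _ h => h.isFiniteLength W α c (stdOrthonormalBasis ℝ E) hα,
    fun M _ _ h => h.isFiniteLength W α c (stdOrthonormalBasis ℝ E) hα⟩
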